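/- Let $g\ge 0$ and $n\ge 1$ be integers with $(g,n)\ne(0,1),(0,2)$. For a positive integer $M$ and a parameter $q\in\mathbb C$ with $q^m\neq 1$ for $1\le m\le M$ (for instance $0<q<1$), consider the rational spectral curve $$x(z)=z+z^{-1},\qquad y^M(z)=\tfrac12\,(z-z^{-1})\prod_{k=1}^M\frac{(1-q^kz^2)(1-q^kz^{-2})}{(1-q^k)^2},\qquad B(z_1,z_2)=\frac{\mathrm dz_1\,\mathrm dz_2}{(z_1-z_2)^2},$$ whose branch points are $\alpha=\pm1$, with local involutions $\sigma(z)=1/z$. Let $\omega^M_{g,n}$ be its correlation differentials, defined by topological recursion: $\omega^M_{0,1}=y^M\,\mathrm dx$, $\omega^M_{0,2}=B$, and, for all other $(g,n)$ and $S=\{2,\dots,n\}$, $$\omega^M_{g,n}(z_1,\boldsymbol z_S)=\sum_{\alpha=\pm1}\operatorname*{Res}_{p=\alpha}K(z_1,p)\Bigl[\omega^M_{g-1,n+1}(p,\sigma(p),\boldsymbol z_S)+\sum^{\circ}_{\substack{g_1+g_2=g\\ I\sqcup J=S}}\omega^M_{g_1,|I|+1}(p,\boldsymbol z_I)\,\omega^M_{g_2,|J|+1}(\sigma(p),\boldsymbol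 z_J)\Bigr],$$ $$K(z_1,p)=\frac12\,\frac{\int_p^{\sigma(p)}\omega^M_{0,2}(z_1,\cdot)}{\omega^M_{0,1}(p)-\omega^M_{0,1}(\sigma(p))},$$ where $\omega^M_{-1,n+1}=0$ and $\circ$ means that terms containing $\omega_{0,1}^M$ are omitted. Near the origin $\omega^M_{g,n}$ has a convergent expansion $$\omega^M_{g,n}(z_1,\dots,z_n)=\sum_{b_1,\dots,b_n=1}^\infty N^M_{g,n}(b_1,\dots,b_n)\prod_{i=1}^n b_i z_i^{b_i-1}\,\mathrm dz_i,$$ which defines $N^M_{g,n}(b_1,\dots,b_n)$ for positive integers $b_i$. Put $\zeta_q^M(2k)=\sum_{m=1}^M \frac{q^{mk}}{(1-q^m)^{2k}}$. Then the following hold. (a) $N^M_{g,n}(b_1,\dots,b_n)$ is a quasi-polynomial in $b_1^2,\dots,b_n^2$: on each parity class of $(b_1,\dots,b_n)$ it is given by a polynomial in $b_1^2,\dots,b_n^2$. (b) Each of these polynomials lies in $\mathbb Q[\zeta_q^M(2),\zeta_q^M(4),\zeta_q^M(6),\dots][b_1^2,\dots,b_n^2]$ and has degree at most $6g-6+2n$,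 where $b_i^2$ has degree $2$ and $\zeta_q^M(2k)$ has degree $2k$. (c) For a fixed parity class, the coefficients of the monomials $\zeta_q^M(2)^{m_1}\zeta_q^M(4)^{m_2}\cdots b_1^{2d_1}\cdots b_n^{2d_n}$ are independent of $M$. Precisely: for each $(g,n)$ and each parity class there is one polynomial $P\in\mathbb Q[Z_2,Z_4,Z_6,\dots][B_1,\dots,B_n]$ of weighted degree at most $6g-6+2n$ (with $\deg Z_{2k}=2k$ and $\deg B_i=2$) such that, for all $M$ and $q$ as above and all $(b_1,\dots,b_n)$ in the class, $N^M_{g,n}(b_1,\dots,b_n)$ is the value of $P$ at $Z_{2k}=\zeta_q^M(2k)$, $B_i=b_i^2$. -/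

import Mathlib

open Filter Topology

/-- Data of a rational spectral curve, in the affine coordinate `z` of the Riemann sphere: two
meromorphic functions `x`, `y`, the finite set of branch points (the zeros of `dx`, all simple and
at finite distance), and for each branch point `α` the non-trivial holomorphic involution `σ α`
defined near `α` that preserves `x`. The symmetric bidifferential is
`B(z₁, z₂) = dz₁ dz₂ / (z₁ - z₂)²`. -/
structure RationalSpectralCurve where
  x : ℂ → ℂ
  y : ℂ → ℂ
  branch : Finset ℂ
  σ : ℂ → ℂ → ℂ
  x_meromorphic : ∀ z, MeromorphicAt x z
  x_meromorphic_infinity : MeromorphicAt (fun w => x w⁻¹) 0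
  y_meromorphic : ∀ z, MeromorphicAt y z
  y_meromorphic_infinity : MeromorphicAt (fun w => y w⁻¹) 0
  mem_branch_iff : ∀ α, α ∈ branch ↔ AnalyticAt ℂ x α ∧ deriv x α = 0
  branch_simple : ∀ α ∈ branch, deriv (deriv x) α ≠ 0
  σ_analytic : ∀ α ∈ branch, AnalyticAt ℂ (σ α) α
  σ_fixed : ∀ α ∈ branch, σ α α = α
  σ_nontrivial : ∀ α ∈ branch, deriv (σ α) α = -1
  x_σ : ∀ α ∈ branch, ∀ᶠ p in 𝓝 α, x (σ α p) = x p

/-- The residue at `α` of `f(z) dz`, as the limit of normalized contour integrals over small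
circles about `α` (which are eventually constant when `f` is meromorphic at `α`). -/
noncomputable def contourResidue (f : ℂ → ℂ) (α : ℂ) : ℂ :=
  limUnder (𝓝[>] (0 : ℝ)) fun r : ℝ => (2 * Real.pi * Complex.I)⁻¹ * ∮ z in C(α, r), f z

namespace RationalSpectralCurve

/-- `ω_{0,1} = y dx`, divided by `dz`. -/
noncomputable def omega01 (C : RationalSpectralCurve) (z : ℂ) : ℂ := C.y z * deriv C.x z

/-- The bidifferential `ω_{0,2} = B`, divided by `dz₁ dz₂`. -/
noncomputable def omega02 (z₁ z₂ : ℂ) : ℂ := 1 / (z₁ - z₂) ^ 2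

/-- The recursion kernel near the branch point `α`, divided by `dz₁ / dp`:
`(1/2) ∫_p^{σ(p)} ω_{0,2}(z₁, ·) / (ω_{0,1}(p) - ω_{0,1}(σ(p)))`. The integral is taken along the
line segment from `p` to `σ(p)`, and `ω_{0,1}(σ(p))` is the pullback of `ω_{0,1}` by `σ`. -/
noncomputable def kernel (C : RationalSpectralCurve) (α z₁ p : ℂ) : ℂ :=
  (1 / 2) *
    (∫ t in (0 : ℝ)..1, omega02 z₁ (p + (t : ℂ) * (C.σ α p - p)) * (C.σ α p - p)) /
    (C.omega01 p - C.omega01 (C.σ α p) * deriv (C.σ α) p)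

/-- The subtuple of `z` indexed by `I`, in increasing order. -/
def subtuple {m : ℕ} (z : Fin m → ℂ) (I : Finset (Fin m)) : Fin I.card → ℂ :=
  fun i => z (I.orderEmbOfFin rfl i)

/-- The correlation differentials of the topological recursion: `C.omega g n z` is
`ω_{g,n}(z₁, …, z_n)` divided by `dz₁ ⋯ dz_n`. Evaluating an argument at `σ(p)` means pulling back,
whence the factors `deriv (C.σ α) p`. In the inner sum `I ⊔ Iᶜ` runs over the splittings of the
last `n - 1` arguments, and the terms with `ω_{0,1}` are omitted. There is no `ω_{g,0}`; the
value `0` there is a convention and is never used. -/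
noncomputable def omega (C : RationalSpectralCurve) : ℕ → (n : ℕ) → (Fin n → ℂ) → ℂ
  | _, 0, _ => 0
  | 0, 1, z => C.omega01 (z 0)
  | 0, 2, z => omega02 (z 0) (z 1)
  | g, m + 1, z =>
    ∑ α ∈ C.branch, contourResidue (fun p =>
      C.kernel α (z 0) p *
        ((if _ : 0 < g then
            C.omega (g - 1) (m + 2) (Fin.cons p (Fin.cons (C.σ α p) (Fin.tail z))) *
              deriv (C.σ α) p
          else 0) +
          ∑ g₁ : Fin (g + 1), ∑ I : Finset (Fin m),
            if _ : ¬ ((g₁ : ℕ) = 0 ∧ I.card = 0) ∧ ¬ (g - (g₁ : ℕ) = 0 ∧ Iᶜ.card = 0) then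
              C.omega g₁ (I.card + 1) (Fin.cons p (subtuple (Fin.tail z) I)) *
                (C.omega (g - g₁) (Iᶜ.card + 1)
                  (Fin.cons (C.σ α p) (subtuple (Fin.tail z) Iᶜ)) * deriv (C.σ α) p)
            else 0)) α
termination_by g n => 2 * g + n
decreasing_by
  · omega
  · have h1 := Finset.card_add_card_compl I
    have h2 := g₁.isLt
    simp only [Fintype.card_fin] at h1
    omega
  · have h1 := Finset.card_add_card_compl I
    have h2 := g₁.isLt
    simp only [Fintype.card_fin] at h1
    omega

end RationalSpectralCurve

/-- The Taylor coefficient at the origin of `f(z₁, …, z_n)` at the monomial `∏ z_i ^ k_i`,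
computed one variable at a time. -/
noncomputable def taylorCoeff : (n : ℕ) → ((Fin n → ℂ) → ℂ) → (Fin n → ℕ) → ℂ
  | 0, f, _ => f Fin.elim0
  | n + 1, f, k =>
    iteratedDeriv (k 0) (fun w => taylorCoeff n (fun z => f (Fin.cons w z)) (Fin.tail k)) 0 /
      ((k 0).factorial : ℂ)

theorem deriv_add_inv {z : ℂ} (hz : z ≠ 0) :
    deriv (fun z : ℂ => z + z⁻¹) z = 1 - (z ^ 2)⁻¹ := by
  have := (hasDerivAt_id z).add (hasDerivAt_inv hz)
  rw [sub_eq_add_neg]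
  exact this.deriv

theorem not_analyticAt_add_inv : ¬ AnalyticAt ℂ (fun z : ℂ => z + z⁻¹) 0 := by
  intro h
  have h1 : ContinuousAt (fun z : ℂ => z⁻¹) 0 := by
    refine (h.continuousAt.sub continuousAt_id).congr (Eventually.of_forall fun z => ?_)
    simp
  have h2 : Tendsto (fun z : ℂ => z⁻¹) (𝓝[≠] 0) (𝓝 0⁻¹) := h1.tendsto.mono_left nhdsWithin_le_nhds
  have h3 := tendsto_inv₀_nhdsNE_zero (α := ℂ)
  exact not_tendsto_nhds_of_tendsto_atTop
    (tendsto_norm_cobounded_atTop.comp h3) _ h2.norm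

theorem deriv_deriv_add_inv {z : ℂ} (hz : z ≠ 0) :
    deriv (deriv fun z : ℂ => z + z⁻¹) z = 2 / z ^ 3 := by
  have h : deriv (fun z : ℂ => z + z⁻¹) =ᶠ[𝓝 z] fun z => 1 - (z ^ 2)⁻¹ := by
    filter_upwards [isOpen_ne.mem_nhds hz] with w hw
    exact deriv_add_inv hw
  rw [h.deriv_eq]
  have h2 := ((hasDerivAt_pow 2 z).inv (pow_ne_zero 2 hz)).const_sub 1
  have h3 := h2.deriv
  simp only [Pi.inv_apply] at h3
  refine Eq.trans h3 ?_
  push_cast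
  field_simp

/-- The truncated spectral curve `x(z) = z + 1/z`,
`y^M(z) = (1/2) (z - 1/z) ∏_{k=1}^M (1 - q^k z²)(1 - q^k z⁻²) / (1 - q^k)²`,
with branch points `±1` and local involutions `z ↦ 1/z`. -/
noncomputable def truncatedCurve (q : ℂ) (M : ℕ) : RationalSpectralCurve where
  x z := z + z⁻¹
  y z := (1 / 2) * (z - z⁻¹) *
    ∏ k ∈ Finset.Icc 1 M, (1 - q ^ k * z ^ 2) * (1 - q ^ k * (z⁻¹) ^ 2) / (1 - q ^ k) ^ 2
  branch := {1, -1}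
  σ _ z := z⁻¹
  x_meromorphic z := by fun_prop
  x_meromorphic_infinity := by fun_prop
  y_meromorphic z := by fun_prop
  y_meromorphic_infinity := by fun_prop
  mem_branch_iff α := by
    by_cases hα : α = 0
    · subst hα
      simp [not_analyticAt_add_inv]
    · rw [deriv_add_inv hα]
      have ha : AnalyticAt ℂ (fun z : ℂ => z + z⁻¹) α := analyticAt_id.add (analyticAt_inv hα)
      simp only [Finset.mem_insert, Finset.mem_singleton, ha, true_and]
      rw [sub_eq_zero, eq_comm (a := (1 : ℂ)), inv_eq_one]
      constructor
      · rintro (rfl | rfl) <;> norm_num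
      · intro h
        rcases mul_eq_zero.1 (show (α - 1) * (α + 1) = 0 by linear_combination h) with h | h
        · exact Or.inl (sub_eq_zero.1 h)
        · exact Or.inr (eq_neg_of_add_eq_zero_left h)
  branch_simple α hα := by
    have h0 : α ≠ 0 := by
      rintro rfl
      simp at hα
    rw [deriv_deriv_add_inv h0]
    exact div_ne_zero two_ne_zero (pow_ne_zero 3 h0)
  σ_analytic α hα := by
    have h0 : α ≠ 0 := by
      rintro rfl
      simp at hα
    exact analyticAt_inv h0
  σ_fixed α hα := by
    simp only [Finset.mem_insert, Finset.mem_singleton] at hα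
    rcases hα with rfl | rfl <;> norm_num
  σ_nontrivial α hα := by
    simp only [Finset.mem_insert, Finset.mem_singleton] at hα
    rcases hα with rfl | rfl <;> simp
  x_σ α _ := Eventually.of_forall fun p => by simp [add_comm]

/-- The discrete volume `N^M_{g,n}(b₁, …, b_n)` of the truncated curve: `∏ b_i` times it is the
coefficient of `∏ z_i ^ (b_i - 1)` in the expansion of `ω^M_{g,n} / (dz₁ ⋯ dz_n)` at the origin. -/
noncomputable def discreteVolume (q : ℂ) (M g n : ℕ) (b : Fin n → ℕ+) : ℂ :=
  taylorCoeff n ((truncatedCurve q M).omega g n) (fun i => (b i : ℕ) - 1) /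
    ∏ i, ((b i : ℕ) : ℂ)

/-- The truncated `q`-zeta function at the even argument `s = 2k`:
`ζ_q^M(2k) = ∑_{m=1}^M q^{mk} / (1 - q^m)^{2k}`. -/
noncomputable def truncatedQZeta (q : ℂ) (M k : ℕ) : ℂ :=
  ∑ m ∈ Finset.Icc 1 M, q ^ (m * k) / (1 - q ^ m) ^ (2 * k)

/-- The parity class of a tuple of positive integers. -/
def parityClass {n : ℕ} (b : Fin n → ℕ+) : Fin n → ZMod 2 := fun i => ((b i : ℕ) : ZMod 2)

/-- `f` is a quasi-polynomial in `b₁², …, b_n²`: on each parity class of tuples of positive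
integers it is given by a polynomial in the `b_i²`. -/
def IsQuasiPolynomialInSquares {n : ℕ} (f : (Fin n → ℕ+) → ℂ) : Prop :=
  ∀ ε : Fin n → ZMod 2, ∃ p : MvPolynomial (Fin n) ℂ, ∀ b : Fin n → ℕ+,
    parityClass b = ε → f b = MvPolynomial.eval (fun i => ((b i : ℕ) : ℂ) ^ 2) p

/-- The grading of the polynomial ring `ℚ[Z₂, Z₄, Z₆, …][B₁, …, B_n]`, in which `Sum.inl k` is the
variable `Z_{2k}` standing for `ζ_q^M(2k)`, of degree `2k`, and `Sum.inr i` is the variable `B_i`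
standing for `b_i²`, of degree `2`. -/
def gradedDegree (n : ℕ) : ℕ+ ⊕ Fin n → ℕ := Sum.elim (fun k => 2 * (k : ℕ)) (fun _ => 2)

/-- The substitution `Z_{2k} = ζ_q^M(2k)`, `B_i = b_i²` into a polynomial in these variables. -/
noncomputable def evalZeta (q : ℂ) (M : ℕ) {n : ℕ} (b : Fin n → ℕ+)
    (P : MvPolynomial (ℕ+ ⊕ Fin n) ℚ) : ℂ :=
  MvPolynomial.aeval
    (Sum.elim (fun k : ℕ+ => truncatedQZeta q M k) (fun i => ((b i : ℕ) : ℂ) ^ 2)) P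

/-!
Write a point near the branch point `α = ±1` as `p = α e ^ t`, so that the involution `p ↦ p⁻¹` is
`t ↦ -t`. With `s = (p - p⁻¹)²` and `a_k = q ^ k / (1 - q ^ k)²` one has
`y = (p - p⁻¹) / 2 * ∏ k, (1 - a_k s)`, so the denominator of the recursion kernel is
`s ∏ k, (1 - a_k s) dt`. The power sums of the `a_k` are the truncated `q`-zeta
values. By Newton's identities (`adm_zetaESymm`) the kernel therefore has a Laurent expansion in
`t` whose coefficients are universal rational polynomials in the `q`-zeta values
(`isLaurent_inv_sqDiff_mul_curveProd`); this is where the independence of `M` and `q` comes from.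

The other ingredient is the family of odd differentials `xi β d` with a pole at `β = ±1` only, whose
expansion at the origin is `∑ b, β ^ b b ^ (2 d + 1) z ^ (b - 1)`. By induction along the recursion
(`omegaFun_mem_adm`) every stable `ω_{g,n}` is a combination of products `∏ i, xi (β i) (d i) (z i)`
with coefficients in `ℚ[ζ(2), ζ(4), …]`; comparing coefficients, such a product contributes
`∏ i, (β i) ^ (b i) (b i) ^ (2 d i)` to the discrete volume, a monomial in the `b i ^ 2` on each
parity class. In the induction step:

* the numerator of the kernel is odd in `t` and expands in the `xi α d (z₁)`;
* a stable factor `p ω(p, …)` is even in `t`, since all the `xi β d` are odd differentials;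
* a factor `B(p, z)` is not, but its even part expands in the `xi α d (z)`, and its odd part meets
  an otherwise odd integrand, hence does not contribute to the residue
  (`hasAdmResidue_of_isLaurent_add_odd`). In `ω_{0,3}`, with two such factors, the kernel has a
  simple pole and only values at the branch point matter.

In particular the symmetry of `ω_{g,n}` is not needed. The degree is counted by giving `t` degree
`-1`: `IsLaurent S w N F` says that the coefficient of `t ^ k` in `F` has degree at most `w + k`.
This is additive under products, a factor `p ω_{g,k+1}(p, …)` has `w = 6 g - 4 + 2 (k + 1)`, the
kernel has `w = 1`, and taking the residue lowers `w` by one.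
-/

namespace DiscreteVolume

/-! ### Residues in a logarithmic coordinate -/

/-- `f` is integrable on all small circles about `α`, with normalized contour integral `c`. -/
def HasResidueAt (f : ℂ → ℂ) (α c : ℂ) : Prop :=
  ∀ᶠ r in 𝓝[>] (0 : ℝ), CircleIntegrable f α r ∧
    (2 * Real.pi * Complex.I)⁻¹ * (∮ z in C(α, r), f z) = c

theorem HasResidueAt.contourResidue_eq {f : ℂ → ℂ} {α c : ℂ} (h : HasResidueAt f α c) :
    contourResidue f α = c := by
  refine Tendsto.limUnder_eq (Tendsto.congr' (f₁ := fun _ => c) ?_ tendsto_const_nhds)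
  filter_upwards [h] with r hr using hr.2.symm

theorem eventually_forall_sphere {p : ℂ → Prop} {α : ℂ} (h : ∀ᶠ z in 𝓝[≠] α, p z) :
    ∀ᶠ r in 𝓝[>] (0 : ℝ), ∀ z ∈ Metric.sphere α r, p z := by
  rw [eventually_nhdsWithin_iff, Metric.eventually_nhds_iff] at h
  obtain ⟨ε, hε, h⟩ := h
  filter_upwards [Ioo_mem_nhdsGT hε] with r hr z hz
  refine h (by rw [Metric.mem_sphere.1 hz]; exact hr.2) ?_
  rintro rfl
  simp only [Metric.mem_sphere, dist_self] at hz
  exact hr.1.ne hz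

theorem eventually_forall_closedBall {p : ℂ → Prop} {α : ℂ} (h : ∀ᶠ z in 𝓝 α, p z) :
    ∀ᶠ r in 𝓝[>] (0 : ℝ), ∀ z ∈ Metric.closedBall α r, p z := by
  rw [Metric.eventually_nhds_iff] at h
  obtain ⟨ε, hε, h⟩ := h
  filter_upwards [Ioo_mem_nhdsGT hε] with r hr z hz
  exact h ((Metric.mem_closedBall.1 hz).trans_lt hr.2)

theorem HasResidueAt.congr {f g : ℂ → ℂ} {α c : ℂ} (h : HasResidueAt f α c)
    (hfg : ∀ᶠ z in 𝓝[≠] α, g z = f z) : HasResidueAt g α c := by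
  filter_upwards [h, eventually_forall_sphere hfg, self_mem_nhdsWithin] with r hr hs hr0
  have hr0' : (0 : ℝ) ≤ r := le_of_lt hr0
  rw [circleIntegral.integral_congr hr0' hs]
  refine ⟨?_, hr.2⟩
  have : (fun θ : ℝ => g (circleMap α r θ)) = fun θ => f (circleMap α r θ) :=
    funext fun θ => hs _ (circleMap_mem_sphere α hr0' θ)
  have h1 := hr.1
  unfold CircleIntegrable at h1 ⊢
  rwa [this]

theorem HasResidueAt.add {f g : ℂ → ℂ} {α c d : ℂ} (hf : HasResidueAt f α c)
    (hg : HasResidueAt g α d) : HasResidueAt (fun z => f z + g z) α (c + d) := by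
  filter_upwards [hf, hg] with r h1 h2
  refine ⟨h1.1.add h2.1, ?_⟩
  rw [circleIntegral.integral_add h1.1 h2.1, mul_add, h1.2, h2.2]

theorem HasResidueAt.const_mul {f : ℂ → ℂ} {α c : ℂ} (a : ℂ) (hf : HasResidueAt f α c) :
    HasResidueAt (fun z => a * f z) α (a * c) := by
  filter_upwards [hf] with r h1
  refine ⟨h1.1.const_fun_smul (a := a), ?_⟩
  rw [circleIntegral.integral_const_mul, mul_left_comm, h1.2]

theorem hasResidueAt_of_analyticAt {f : ℂ → ℂ} {α : ℂ} (hf : AnalyticAt ℂ f α) :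
    HasResidueAt f α 0 := by
  filter_upwards [eventually_forall_closedBall hf.eventually_analyticAt,
    self_mem_nhdsWithin] with r hr hr0
  have hr0' : (0 : ℝ) ≤ r := le_of_lt hr0
  have hc : ContinuousOn f (Metric.closedBall α r) :=
    fun z hz => (hr z hz).continuousAt.continuousWithinAt
  refine ⟨(hc.mono Metric.sphere_subset_closedBall).circleIntegrable hr0', ?_⟩
  rw [Complex.circleIntegral_eq_zero_of_differentiable_on_off_countable hr0' Set.countable_empty hc
    (fun z hz => (hr z (Metric.ball_subset_closedBall hz.1)).differentiableAt), mul_zero]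

theorem HasResidueAt.sum {ι : Type*} (s : Finset ι) {f : ι → ℂ → ℂ} {α : ℂ} {c : ι → ℂ}
    (h : ∀ i ∈ s, HasResidueAt (f i) α (c i)) :
    HasResidueAt (fun z => ∑ i ∈ s, f i z) α (∑ i ∈ s, c i) := by
  classical
  induction s using Finset.induction_on with
  | empty => simpa using hasResidueAt_of_analyticAt (α := α) (f := fun _ => 0) analyticAt_const
  | insert a s ha ih =>
    simp only [Finset.sum_insert ha]
    exact (h a (Finset.mem_insert_self a s)).add
      (ih fun i hi => h i (Finset.mem_insert_of_mem hi))

theorem hasResidueAt_of_hasDerivAt {F f : ℂ → ℂ} {α : ℂ}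
    (hF : ∀ᶠ z in 𝓝[≠] α, HasDerivAt F (f z) z) (hf : ∀ᶠ z in 𝓝[≠] α, ContinuousAt f z) :
    HasResidueAt f α 0 := by
  filter_upwards [eventually_forall_sphere hF, eventually_forall_sphere hf,
    self_mem_nhdsWithin] with r h1 h2 hr0
  have hr0' : (0 : ℝ) ≤ r := le_of_lt hr0
  refine ⟨ContinuousOn.circleIntegrable hr0' fun z hz => (h2 z hz).continuousWithinAt, ?_⟩
  rw [circleIntegral.integral_eq_zero_of_hasDerivWithinAt hr0'
    fun z hz => (h1 z hz).hasDerivWithinAt, mul_zero]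

theorem hasResidueAt_inv (α : ℂ) : HasResidueAt (fun z => (z - α)⁻¹) α 1 := by
  filter_upwards [self_mem_nhdsWithin] with r hr
  have hr0 : (0 : ℝ) < r := hr
  constructor
  · refine ContinuousOn.circleIntegrable hr0.le fun z hz => ?_
    refine ContinuousAt.continuousWithinAt (ContinuousAt.inv₀ (by fun_prop) ?_)
    rw [sub_ne_zero]
    rintro rfl
    simp only [Metric.mem_sphere, dist_self] at hz
    exact hr0.ne hz
  · rw [circleIntegral.integral_sub_center_inv _ hr0.ne']
    exact inv_mul_cancel₀ (by simp [Real.pi_ne_zero])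

/-- A logarithmic derivative `v' / v` has residue `1` at a simple zero of `v`. -/
theorem hasResidueAt_logDeriv {v : ℂ → ℂ} {α : ℂ} (hv : AnalyticAt ℂ v α) (h0 : v α = 0)
    (h1 : deriv v α ≠ 0) : HasResidueAt (fun z => deriv v z / v z) α 1 := by
  obtain ⟨p, hp⟩ := hv
  have hw : AnalyticAt ℂ (dslope v α) α := ⟨_, hp.has_fpower_series_dslope_fslope⟩
  have hw0 : dslope v α α ≠ 0 := by rwa [dslope_same]
  have key := (hasResidueAt_inv α).add
    (hasResidueAt_of_analyticAt (hw.deriv.div hw hw0))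
  rw [add_zero] at key
  refine key.congr ?_
  filter_upwards [hw.eventually_analyticAt.filter_mono nhdsWithin_le_nhds,
    (hw.continuousAt.eventually_ne hw0).filter_mono nhdsWithin_le_nhds,
    self_mem_nhdsWithin] with z h2 h3 h4
  have hz : z - α ≠ 0 := sub_ne_zero.2 h4
  have hvz : v = fun z => (z - α) * dslope v α z := by
    funext z
    have := sub_smul_dslope v α z
    rw [h0, sub_zero, smul_eq_mul] at this
    exact this.symm
  have hd : deriv v z = dslope v α z + (z - α) * deriv (dslope v α) z := by
    conv_lhs => rw [hvz]
    have : HasDerivAt (fun z => (z - α) * dslope v α z) _ z :=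
      ((hasDerivAt_id z).sub_const α).mul h2.differentiableAt.hasDerivAt
    simpa using this.deriv
  have hvz' : v z = (z - α) * dslope v α z := congrFun hvz z
  rw [hd, hvz']
  simp only [Pi.div_apply]
  field_simp

/-- In the coordinate `t` given by `p = α e ^ t` with `α ^ 2 = 1`, the residue at `α` of the
differential `f(p) dp = h(t) t ^ (-N - 1) dt` is the coefficient of `t ^ N` in `h`. -/
theorem hasResidueAt_of_exp {f h : ℂ → ℂ} {α : ℂ} (hα : α ^ 2 = 1) {N : ℕ}
    (hh : AnalyticAt ℂ h 0)
    (hf : ∀ᶠ t in 𝓝[≠] (0 : ℂ),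
      f (α * Complex.exp t) * (α * Complex.exp t) = h t / t ^ (N + 1)) :
    HasResidueAt f α (iteratedDeriv N h 0 / N.factorial) := by
  have hαα : α * α = 1 := by rw [← sq, hα]
  have hα0 : α ≠ 0 := left_ne_zero_of_mul_eq_one hαα
  set L : ℂ → ℂ := fun p => Complex.log (α * p) with hL
  have hLα : L α = 0 := by simp [hL, hαα]
  have hLd : ∀ᶠ p in 𝓝 α, AnalyticAt ℂ L p ∧ HasDerivAt L p⁻¹ p ∧ p ≠ 0 ∧
      α * Complex.exp (L p) = p := by
    have hs : ∀ᶠ p in 𝓝 α, α * p ∈ Complex.slitPlane := by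
      have : ContinuousAt (fun p : ℂ => α * p) α := by fun_prop
      refine this.eventually_mem (Complex.isOpen_slitPlane.mem_nhds ?_)
      rw [hαα]
      exact Complex.one_mem_slitPlane
    filter_upwards [hs, isOpen_ne.mem_nhds hα0] with p hp hp0
    refine ⟨(analyticAt_const.mul analyticAt_id).clog hp, ?_, hp0, ?_⟩
    · have : HasDerivAt L _ p := ((hasDerivAt_id p).const_mul α).clog hp
      refine this.congr_deriv ?_
      simp only [id]
      field_simp
    · rw [Complex.exp_log (mul_ne_zero hα0 hp0), ← mul_assoc, hαα, one_mul]
  have hLa : AnalyticAt ℂ L α := hLd.self_of_nhds.1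
  have hLne : ∀ᶠ p in 𝓝[≠] α, L p ≠ 0 := by
    filter_upwards [hLd.filter_mono nhdsWithin_le_nhds, self_mem_nhdsWithin] with p hp hne h0
    rw [h0, Complex.exp_zero, mul_one] at hp
    exact hne hp.2.2.2.symm
  have hLt : Tendsto L (𝓝[≠] α) (𝓝[≠] 0) := by
    refine tendsto_nhdsWithin_of_tendsto_nhds_of_eventually_within _ ?_ hLne
    have := hLa.continuousAt.tendsto
    rw [hLα] at this
    exact this.mono_left nhdsWithin_le_nhds
  obtain ⟨F, hFa, hF⟩ := hh.exists_eq_sum_add_pow_mul (N + 1)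
  have hlog : HasResidueAt (fun p => (L p)⁻¹ * p⁻¹) α 1 := by
    refine (hasResidueAt_logDeriv hLa hLα ?_).congr ?_
    · rw [hLd.self_of_nhds.2.1.deriv]
      exact inv_ne_zero hα0
    · filter_upwards [hLd.filter_mono nhdsWithin_le_nhds] with p hp
      rw [hp.2.1.deriv]
      ring
  have hterm : ∀ i ∈ Finset.range (N + 1),
      HasResidueAt (fun p => iteratedDeriv i h 0 / i.factorial * (L p ^ i / L p ^ (N + 1) * p⁻¹)) α
        (iteratedDeriv i h 0 / i.factorial * if i = N then 1 else 0) := by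
    intro i hi
    refine HasResidueAt.const_mul _ ?_
    have hi' := Finset.mem_range.1 hi
    split_ifs with hiN
    · subst hiN
      refine hlog.congr ?_
      filter_upwards [hLne] with p hp
      rw [pow_succ]
      field_simp
    · obtain ⟨j, hj⟩ : ∃ j, N = i + (j + 1) := ⟨N - i - 1, by omega⟩
      have hj0 : ((j : ℂ) + 1) ≠ 0 := Nat.cast_add_one_ne_zero j
      refine hasResidueAt_of_hasDerivAt (F := fun p => -((j : ℂ) + 1)⁻¹ * (L p ^ (j + 1))⁻¹) ?_ ?_
      · filter_upwards [hLne, hLd.filter_mono nhdsWithin_le_nhds] with p hp hp2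
        have := ((hp2.2.1.pow (j + 1)).inv (pow_ne_zero _ hp)).const_mul (-((j : ℂ) + 1)⁻¹)
        refine this.congr_deriv ?_
        have h3 := hp2.2.2.1
        rw [hj]
        simp only [Pi.pow_apply, Nat.add_sub_cancel]
        push_cast
        field_simp
        ring
      · filter_upwards [hLne, hLd.filter_mono nhdsWithin_le_nhds] with p hp hp2
        have h3 := hp2.1.continuousAt
        have h4 := hp2.2.2.1
        exact ((h3.pow _).div (h3.pow _) (pow_ne_zero _ hp)).mul (continuousAt_id.inv₀ h4)
  have hrem : HasResidueAt (fun p => F (L p) * p⁻¹) α 0 := by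
    refine hasResidueAt_of_analyticAt (AnalyticAt.mul ?_ (analyticAt_inv hα0))
    exact AnalyticAt.fun_comp (by rwa [hLα]) hLa
  have key := (HasResidueAt.sum _ hterm).add hrem
  simp only [mul_ite, mul_one, mul_zero, Finset.sum_ite_eq', Finset.mem_range, Nat.lt_succ_self,
    if_true, add_zero] at key
  refine key.congr ?_
  filter_upwards [hLt.eventually hf, hLne, hLd.filter_mono nhdsWithin_le_nhds] with p h1 h2 h3
  rw [h3.2.2.2] at h1
  have h4 := h3.2.2.1
  have h5 : f p = h (L p) / L p ^ (N + 1) * p⁻¹ := by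
    rw [← h1]; field_simp
  rw [h5, hF (L p), add_div, add_mul, Finset.sum_div, Finset.sum_mul]
  congr 1
  · refine Finset.sum_congr rfl fun i _ => ?_
    rw [smul_eq_mul]; ring
  · rw [smul_eq_mul]
    field_simp

/-! ### Admissible functions -/

/-- The parameters of a truncated curve: a level `M` and a value of `q` for which it is defined. -/
structure CurveParam where
  M : ℕ
  q : ℂ
  pow_ne_one : ∀ m ∈ Finset.Icc 1 M, q ^ m ≠ 1

/-- The points none of whose coordinates is a branch point. -/
def offBranch (n : ℕ) : Set (Fin n → ℂ) := {z | ∀ i, z i ≠ 1 ∧ z i ≠ -1}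

/-- The sign `β = ±1`, as a complex number: a branch point. -/
def sgn (β : ℤˣ) : ℂ := ((β : ℤ) : ℂ)

theorem sgn_mul_self (β : ℤˣ) : sgn β * sgn β = 1 := by
  rcases Int.units_eq_one_or β with rfl | rfl <;> norm_num [sgn]

theorem sgn_sq (β : ℤˣ) : sgn β ^ 2 = 1 := by rw [sq, sgn_mul_self]

theorem sgn_ne_zero (β : ℤˣ) : sgn β ≠ 0 := left_ne_zero_of_mul_eq_one (sgn_mul_self β)

theorem sgn_inv (β : ℤˣ) : (sgn β)⁻¹ = sgn β := inv_eq_of_mul_eq_one_right (sgn_mul_self β)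

/-- The function `p / (1 - p z)` of the point `p = β e ^ t`. Its expansion at `z = 0` is
`∑ b, β ^ b e ^ (b t) z ^ (b - 1)`, so that `t`-derivatives bring down powers of `b`. -/
noncomputable def chi (β : ℤˣ) (z t : ℂ) : ℂ :=
  sgn β * Complex.exp t / (1 - sgn β * Complex.exp t * z)

/-- The elementary odd differential with its only pole at the branch point `β`, divided by `dz`;
its expansion at the origin is `∑ b, β ^ b b ^ (2 d + 1) z ^ (b - 1)`. -/
noncomputable def xi (β : ℤˣ) (d : ℕ) (z : ℂ) : ℂ := iteratedDeriv (2 * d + 1) (chi β z) 0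

/-- The value of the monomial `∏ k, Z_{2k} ^ μ k` at the truncated `q`-zeta values. -/
noncomputable def zetaMonomial (θ : CurveParam) (μ : ℕ+ →₀ ℕ) : ℂ :=
  μ.prod fun k e => truncatedQZeta θ.q θ.M k ^ e

/-- The degree of the monomial `∏ k, Z_{2k} ^ μ k`, where `Z_{2k}` has degree `2 k`. -/
noncomputable def zetaWeight (μ : ℕ+ →₀ ℕ) : ℕ := Finsupp.weight (fun k : ℕ+ => 2 * (k : ℕ)) μ

/-- The products of a monomial in the `q`-zeta values and one elementary differential in each of
the variables in `S`, of total degree at most `w`; here `xi β d` has degree `2 d`. -/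
def admGen {n : ℕ} (S : Finset (Fin n)) (w : ℤ) : Set (CurveParam → (Fin n → ℂ) → ℂ) :=
  {f | ∃ (μ : ℕ+ →₀ ℕ) (β : Fin n → ℤˣ) (d : Fin n → ℕ),
    (zetaWeight μ : ℤ) + 2 * ∑ i ∈ S, (d i : ℤ) ≤ w ∧
    f = fun θ z => zetaMonomial θ μ * ∏ i ∈ S, xi (β i) (d i) (z i)}

/-- The rational combinations of the functions in `admGen S w`, up to equality away from the
branch points. -/
def adm {n : ℕ} (S : Finset (Fin n)) (w : ℤ) :
    Submodule ℚ (CurveParam → (Fin n → ℂ) → ℂ) where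
  carrier := {f | ∃ c ∈ Submodule.span ℚ (admGen S w), ∀ θ, ∀ z ∈ offBranch n, f θ z = c θ z}
  zero_mem' := ⟨0, Submodule.zero_mem _, fun _ _ _ => rfl⟩
  add_mem' := by
    rintro f g ⟨c, hc, hfc⟩ ⟨d, hd, hgd⟩
    exact ⟨c + d, Submodule.add_mem _ hc hd, fun θ z hz => by
      simp only [Pi.add_apply, hfc θ z hz, hgd θ z hz]⟩
  smul_mem' := by
    rintro r f ⟨c, hc, hfc⟩
    exact ⟨r • c, Submodule.smul_mem _ r hc, fun θ z hz => by
      simp only [Pi.smul_apply, hfc θ z hz]⟩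

section Adm

variable {n : ℕ} {S T : Finset (Fin n)} {w v : ℤ} {f g : CurveParam → (Fin n → ℂ) → ℂ}

theorem adm_congr (hf : f ∈ adm S w) (h : ∀ θ, ∀ z ∈ offBranch n, g θ z = f θ z) :
    g ∈ adm S w := by
  obtain ⟨c, hc, hfc⟩ := hf
  exact ⟨c, hc, fun θ z hz => (h θ z hz).trans (hfc θ z hz)⟩

theorem adm_mono (h : w ≤ v) (hf : f ∈ adm S w) : f ∈ adm S v := by
  obtain ⟨c, hc, hfc⟩ := hf
  refine ⟨c, Submodule.span_mono ?_ hc, hfc⟩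
  rintro _ ⟨μ, β, d, hw, rfl⟩
  exact ⟨μ, β, d, hw.trans h, rfl⟩

theorem adm_of_gen (hf : f ∈ admGen S w) : f ∈ adm S w :=
  ⟨f, Submodule.subset_span hf, fun _ _ _ => rfl⟩

/-- There are no monomials of negative degree. This encodes the vanishing of the coefficients below
the pole order of an expansion. -/
theorem eq_zero_of_adm_neg (hw : w < 0) (hf : f ∈ adm S w) (θ : CurveParam) {z : Fin n → ℂ}
    (hz : z ∈ offBranch n) : f θ z = 0 := by
  obtain ⟨c, hc, hfc⟩ := hf
  have : admGen S w = ∅ := by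
    rw [Set.eq_empty_iff_forall_notMem]
    rintro _ ⟨μ, β, d, h, rfl⟩
    have : 0 ≤ ∑ i ∈ S, (d i : ℤ) := Finset.sum_nonneg fun _ _ => Int.natCast_nonneg _
    have := Int.natCast_nonneg (zetaWeight μ)
    omega
  rw [this, Submodule.span_empty, Submodule.mem_bot] at hc
  rw [hfc θ z hz, hc]
  rfl

/-- The two factors have to involve disjoint sets of variables. -/
theorem adm_mul (hST : Disjoint S T) (hf : f ∈ adm S w) (hg : g ∈ adm T v) :
    (fun θ z => f θ z * g θ z) ∈ adm (S ∪ T) (w + v) := by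
  classical
  obtain ⟨c, hc, hfc⟩ := hf
  obtain ⟨e, he, hge⟩ := hg
  refine ⟨c * e, ?_, fun θ z hz =>
    congrArg₂ (· * ·) (hfc θ z hz) (hge θ z hz)⟩
  have := Submodule.mul_mem_mul hc he
  rw [Submodule.span_mul_span] at this
  refine Submodule.span_mono ?_ this
  rintro _ ⟨_, ⟨μ, β, d, h1, rfl⟩, _, ⟨μ', β', d', h2, rfl⟩, rfl⟩
  have hT : ∀ i ∈ T, i ∉ S := fun i hi => Finset.disjoint_right.1 hST hi
  refine ⟨μ + μ', fun i => if i ∈ S then β i else β' i, fun i => if i ∈ S then d i else d' i,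
    ?_, ?_⟩
  · rw [Finset.sum_union hST]
    have e1 : ∑ i ∈ S, (((if i ∈ S then d i else d' i : ℕ)) : ℤ) = ∑ i ∈ S, (d i : ℤ) :=
      Finset.sum_congr rfl fun i hi => by rw [if_pos hi]
    have e2 : ∑ i ∈ T, (((if i ∈ S then d i else d' i : ℕ)) : ℤ) = ∑ i ∈ T, (d' i : ℤ) :=
      Finset.sum_congr rfl fun i hi => by rw [if_neg (hT i hi)]
    have e3 : zetaWeight (μ + μ') = zetaWeight μ + zetaWeight μ' := map_add _ _ _
    rw [e1, e2, e3]
    push_cast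
    linarith
  · funext θ z
    have e1 : ∏ i ∈ S, xi (if i ∈ S then β i else β' i) (if i ∈ S then d i else d' i) (z i) =
        ∏ i ∈ S, xi (β i) (d i) (z i) :=
      Finset.prod_congr rfl fun i hi => by rw [if_pos hi, if_pos hi]
    have e2 : ∏ i ∈ T, xi (if i ∈ S then β i else β' i) (if i ∈ S then d i else d' i) (z i) =
        ∏ i ∈ T, xi (β' i) (d' i) (z i) :=
      Finset.prod_congr rfl fun i hi => by rw [if_neg (hT i hi), if_neg (hT i hi)]
    have e3 : zetaMonomial θ (μ + μ') = zetaMonomial θ μ * zetaMonomial θ μ' :=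
      Finsupp.prod_add_index' (fun _ => pow_zero _) (fun _ _ _ => pow_add _ _ _)
    rw [Finset.prod_union hST, e1, e2, e3]
    simp only [Pi.mul_apply]
    ring

theorem adm_mul_left (hf : f ∈ adm (∅ : Finset (Fin n)) w) (hg : g ∈ adm S v) :
    (fun θ z => f θ z * g θ z) ∈ adm S (w + v) := by
  simpa using adm_mul (Finset.disjoint_empty_left S) hf hg

theorem adm_ratCast_mul (r : ℚ) (hf : f ∈ adm S w) : (fun θ z => (r : ℂ) * f θ z) ∈ adm S w :=
  adm_congr (Submodule.smul_mem _ r hf) fun θ z _ => by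
    simp only [Pi.smul_apply, Rat.smul_def]

theorem adm_sum {ι : Type*} (s : Finset ι) {F : ι → CurveParam → (Fin n → ℂ) → ℂ}
    (h : ∀ i ∈ s, F i ∈ adm S w) : (fun θ z => ∑ i ∈ s, F i θ z) ∈ adm S w :=
  adm_congr (Submodule.sum_mem _ h) fun θ z _ => by simp only [Finset.sum_apply]

theorem adm_ratCast (r : ℚ) (hw : 0 ≤ w) :
    (fun _ _ => (r : ℂ)) ∈ adm (∅ : Finset (Fin n)) w := by
  have h1 : (fun _ _ => 1) ∈ adm (∅ : Finset (Fin n)) w := by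
    refine adm_of_gen ⟨0, fun _ => 1, fun _ => 0, ?_, ?_⟩
    · simpa [zetaWeight] using hw
    · simp [zetaMonomial]
  simpa using adm_ratCast_mul r h1

theorem adm_zeta (k : ℕ+) : (fun θ _ => truncatedQZeta θ.q θ.M k) ∈
    adm (∅ : Finset (Fin n)) (2 * (k : ℕ)) := by
  refine adm_of_gen ⟨Finsupp.single k 1, fun _ => 1, fun _ => 0, ?_, ?_⟩
  · simp [zetaWeight, Finsupp.weight_apply]
  · simp [zetaMonomial]

theorem adm_xi (i : Fin n) (β : ℤˣ) (d : ℕ) :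
    (fun _ z => xi β d (z i)) ∈ adm ({i} : Finset (Fin n)) (2 * d) :=
  adm_of_gen ⟨0, fun _ => β, fun _ => d, by simp [zetaWeight], by simp [zetaMonomial]⟩

end Adm

theorem iteratedDeriv_succ_id_mul {g : ℂ → ℂ} (hg : AnalyticAt ℂ g 0) (k : ℕ) :
    iteratedDeriv (k + 1) (fun t => t * g t) 0 = (k + 1) * iteratedDeriv k g 0 := by
  rw [iteratedDeriv_fun_mul (f := fun t : ℂ => t) analyticAt_id.contDiffAt hg.contDiffAt,
    Finset.sum_eq_single 1]
  · rw [iteratedDeriv_fun_id_zero]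
    simp
  · intro b _ hb
    rw [iteratedDeriv_fun_id_zero, if_neg hb]
    simp
  · intro hk
    simp at hk

/-! ### Laurent expansions with admissible coefficients -/

/-- Near `t = 0` the function `F` is `h(t) / t ^ N`, where `h` is analytic and the coefficient of
`t ^ k` in `F` is admissible of degree at most `w + k`. The coefficient of `t ^ k` in `h` is stated
as `iteratedDeriv k h 0`, which differs from it by the rational factor `k!`. -/
def IsLaurent {n : ℕ} (S : Finset (Fin n)) (w : ℤ) (N : ℕ)
    (F : CurveParam → (Fin n → ℂ) → ℂ → ℂ) : Prop :=
  ∃ h : CurveParam → (Fin n → ℂ) → ℂ → ℂ,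
    (∀ k : ℕ, (fun θ z => iteratedDeriv k (h θ z) 0) ∈ adm S (w - N + k)) ∧
    ∀ θ, ∀ z ∈ offBranch n, AnalyticAt ℂ (h θ z) 0 ∧ ∀ᶠ t in 𝓝[≠] 0, F θ z t = h θ z t / t ^ N

section IsLaurent

variable {n : ℕ} {S T : Finset (Fin n)} {w v : ℤ} {N K : ℕ}
  {F G : CurveParam → (Fin n → ℂ) → ℂ → ℂ}

theorem IsLaurent.congr (hF : IsLaurent S w N F)
    (h : ∀ θ, ∀ z ∈ offBranch n, ∀ᶠ t in 𝓝[≠] 0, G θ z t = F θ z t) : IsLaurent S w N G := by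
  obtain ⟨a, ha, hF⟩ := hF
  refine ⟨a, ha, fun θ z hz => ⟨(hF θ z hz).1, ?_⟩⟩
  filter_upwards [h θ z hz, (hF θ z hz).2] with t h1 h2
  rw [h1, h2]

theorem isLaurent_of_analytic
    (hF : ∀ θ, ∀ z ∈ offBranch n, AnalyticAt ℂ (F θ z) 0)
    (h : ∀ k : ℕ, (fun θ z => iteratedDeriv k (F θ z) 0) ∈ adm S (w + k)) :
    IsLaurent S w 0 F :=
  ⟨F, by simpa using h, fun θ z hz => ⟨hF θ z hz, by simp⟩⟩

theorem IsLaurent.mono (h : w ≤ v) (hF : IsLaurent S w N F) : IsLaurent S v N F := by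
  obtain ⟨a, ha, hF⟩ := hF
  exact ⟨a, fun k => adm_mono (by omega) (ha k), hF⟩

theorem IsLaurent.mul (hST : Disjoint S T) (hF : IsLaurent S w N F) (hG : IsLaurent T v K G) :
    IsLaurent (S ∪ T) (w + v) (N + K) fun θ z t => F θ z t * G θ z t := by
  obtain ⟨a, ha, hF⟩ := hF
  obtain ⟨b, hb, hG⟩ := hG
  refine ⟨fun θ z t => a θ z t * b θ z t, fun k => ?_, fun θ z hz =>
    ⟨(hF θ z hz).1.fun_mul (hG θ z hz).1, ?_⟩⟩
  · refine adm_congr (adm_sum (Finset.range (k + 1)) fun i hi => adm_ratCast_mul (k.choose i)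
      (adm_mono ?_ (adm_mul hST (ha i) (hb (k - i))))) fun θ z hz => ?_
    · have := Finset.mem_range.1 hi
      push_cast [Nat.le_of_lt_succ this]
      omega
    · rw [iteratedDeriv_fun_mul (hF θ z hz).1.contDiffAt (hG θ z hz).1.contDiffAt]
      refine Finset.sum_congr rfl fun i _ => ?_
      push_cast
      ring
  · filter_upwards [(hF θ z hz).2, (hG θ z hz).2] with t h1 h2
    rw [h1, h2, pow_add]
    exact div_mul_div_comm _ _ _ _

theorem IsLaurent.mul_left (hF : IsLaurent (∅ : Finset (Fin n)) w N F) (hG : IsLaurent S v K G) :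
    IsLaurent S (w + v) (N + K) fun θ z t => F θ z t * G θ z t := by
  simpa using IsLaurent.mul (Finset.disjoint_empty_left S) hF hG

theorem IsLaurent.add (hF : IsLaurent S w N F) (hG : IsLaurent S w N G) :
    IsLaurent S w N fun θ z t => F θ z t + G θ z t := by
  obtain ⟨a, ha, hF⟩ := hF
  obtain ⟨b, hb, hG⟩ := hG
  refine ⟨fun θ z t => a θ z t + b θ z t, fun k => ?_, fun θ z hz =>
    ⟨(hF θ z hz).1.fun_add (hG θ z hz).1, ?_⟩⟩
  · refine adm_congr (Submodule.add_mem (adm S (w - N + k)) (ha k) (hb k)) fun θ z hz => ?_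
    exact iteratedDeriv_fun_add (hF θ z hz).1.contDiffAt (hG θ z hz).1.contDiffAt
  · filter_upwards [(hF θ z hz).2, (hG θ z hz).2] with t h1 h2
    rw [h1, h2, add_div]

theorem IsLaurent.const_mul {f : CurveParam → (Fin n → ℂ) → ℂ}
    (hf : f ∈ adm T v) (hST : Disjoint T S) (hF : IsLaurent S w N F) :
    IsLaurent (T ∪ S) (v + w) N fun θ z t => f θ z * F θ z t := by
  obtain ⟨a, ha, hF⟩ := hF
  refine ⟨fun θ z t => f θ z * a θ z t, fun k => ?_, fun θ z hz =>
    ⟨analyticAt_const.fun_mul (hF θ z hz).1, ?_⟩⟩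
  · refine adm_congr (adm_mono (by omega) (adm_mul hST hf (ha k))) fun θ z hz => ?_
    exact iteratedDeriv_const_mul_field _ _
  · filter_upwards [(hF θ z hz).2] with t h1
    rw [h1, mul_div_assoc]

theorem IsLaurent.ratCast_mul (r : ℚ) (hF : IsLaurent S w N F) :
    IsLaurent S w N fun θ z t => (r : ℂ) * F θ z t := by
  simpa using IsLaurent.const_mul (adm_ratCast r le_rfl) (Finset.disjoint_empty_left S) hF

/-- Raising the bound on the pole order. -/
theorem IsLaurent.add_order (hF : IsLaurent S w N F) (j : ℕ) : IsLaurent S w (N + j) F := by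
  have h1 : IsLaurent (∅ : Finset (Fin n)) 0 j fun _ _ _ => 1 := by
    refine ⟨fun _ _ t => t ^ j, fun k => ?_, fun θ z hz => ⟨by fun_prop, ?_⟩⟩
    · simp only [iteratedDeriv_fun_pow_zero]
      by_cases hk : k = j
      · subst hk
        simpa using adm_ratCast (n := n) (w := 0 - (k : ℤ) + k) (k.factorial : ℚ) (by simp)
      · simp only [if_neg hk, Nat.cast_zero]
        exact (adm ∅ _).zero_mem
    · filter_upwards [self_mem_nhdsWithin] with t ht
      exact (div_self (pow_ne_zero _ ht)).symm
  have := h1.mul_left hF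
  rw [zero_add, add_comm] at this
  simpa using this

theorem IsLaurent.mono_order (h : N ≤ K) (hF : IsLaurent S w N F) : IsLaurent S w K F := by
  obtain ⟨j, rfl⟩ := Nat.exists_eq_add_of_le h
  exact hF.add_order j

/-- Differentiation with respect to `t` raises the degree by one. -/
theorem IsLaurent.deriv (hF : IsLaurent S w N F) :
    IsLaurent S (w + 1) (N + 1) fun θ z => deriv (F θ z) := by
  obtain ⟨a, ha, hF⟩ := hF
  have hsum : ∀ θ, ∀ z ∈ offBranch n, ∀ k : ℕ,
      iteratedDeriv k (fun t => t * _root_.deriv (a θ z) t - N * a θ z t) 0 =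
        ((k - N : ℚ) : ℂ) * iteratedDeriv k (a θ z) 0 := by
    intro θ z hz k
    have h1 := (hF θ z hz).1
    have h0 : AnalyticAt ℂ (fun t : ℂ => t * _root_.deriv (a θ z) t) 0 :=
      analyticAt_id.fun_mul h1.deriv
    rw [iteratedDeriv_fun_sub h0.contDiffAt
      (analyticAt_const.fun_mul h1).contDiffAt, iteratedDeriv_const_mul_field]
    have h2 : iteratedDeriv k (fun t => t * _root_.deriv (a θ z) t) 0 =
        k * iteratedDeriv k (a θ z) 0 := by
      rcases k with _ | k
      · simp
      · rw [iteratedDeriv_succ_id_mul h1.deriv, ← iteratedDeriv_succ']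
        push_cast
        rfl
    rw [h2]
    push_cast
    ring
  refine ⟨fun θ z t => t * _root_.deriv (a θ z) t - N * a θ z t, fun k => ?_, fun θ z hz =>
    ⟨?_, ?_⟩⟩
  · exact adm_congr (adm_mono (by push_cast; omega) (adm_ratCast_mul (k - N) (ha k)))
      fun θ z hz => hsum θ z hz k
  · have h1 := (hF θ z hz).1
    exact (analyticAt_id.fun_mul h1.deriv).fun_sub (analyticAt_const.fun_mul h1)
  · filter_upwards [eventually_eventually_nhdsWithin.2 (hF θ z hz).2, self_mem_nhdsWithin,
      (hF θ z hz).1.eventually_analyticAt.filter_mono nhdsWithin_le_nhds] with t h1 ht h2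
    have ht' : t ≠ 0 := ht
    rw [nhdsWithin_eq_nhds.2 (isOpen_compl_singleton.mem_nhds ht)] at h1
    rw [EventuallyEq.deriv_eq h1]
    have := h2.differentiableAt.hasDerivAt.fun_div (hasDerivAt_pow N t) (pow_ne_zero N ht')
    rw [this.deriv]
    rcases N with _ | N
    · simp
      field_simp
    · simp only [Nat.add_sub_cancel]
      field_simp
      ring

/-- Inversion of a series with rational constant term. -/
theorem IsLaurent.inv (hF : IsLaurent (∅ : Finset (Fin n)) 0 0 F) {r : ℚ} (hr : r ≠ 0)
    (hF0 : ∀ θ, ∀ z ∈ offBranch n, Tendsto (F θ z) (𝓝[≠] 0) (𝓝 (r : ℂ))) :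
    IsLaurent (∅ : Finset (Fin n)) 0 0 fun θ z t => (F θ z t)⁻¹ := by
  obtain ⟨a, ha, hF⟩ := hF
  have hr' : (r : ℂ) ≠ 0 := Rat.cast_ne_zero.2 hr
  have ha0 : ∀ θ, ∀ z ∈ offBranch n, a θ z 0 = r := by
    intro θ z hz
    refine tendsto_nhds_unique ((hF θ z hz).1.continuousAt.tendsto.mono_left nhdsWithin_le_nhds)
      ((hF0 θ z hz).congr' ?_)
    filter_upwards [(hF θ z hz).2] with t ht
    simpa using ht
  have hinv : ∀ θ, ∀ z ∈ offBranch n, AnalyticAt ℂ (fun t => (a θ z t)⁻¹) 0 := by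
    intro θ z hz
    refine (hF θ z hz).1.inv ?_
    rw [ha0 θ z hz]
    exact hr'
  refine ⟨fun θ z t => (a θ z t)⁻¹, fun k => ?_, fun θ z hz => ⟨hinv θ z hz, ?_⟩⟩
  · induction k using Nat.strong_induction_on with
    | _ k ih =>
      rcases k with _ | k
      · refine adm_congr (adm_ratCast (r⁻¹) (by simp)) fun θ z hz => ?_
        simp [ha0 θ z hz]
      · -- Leibniz' rule for `a * a⁻¹ = 1`, solved for the top derivative of `a⁻¹`.
        refine adm_congr (adm_ratCast_mul (-r⁻¹) (adm_sum (Finset.range (k + 1)) (fun i hi =>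
          adm_ratCast_mul ((k + 1).choose (i + 1)) (adm_mono ?_ (adm_mul_left (ha (i + 1))
            (ih (k - i) (by omega))))))) fun θ z hz => ?_
        · have := Finset.mem_range.1 hi
          push_cast [Nat.le_of_lt_succ this]
          omega
        · have h1 := iteratedDeriv_fun_mul (n := k + 1) (hF θ z hz).1.contDiffAt
            (hinv θ z hz).contDiffAt
          have h2 : (fun t => a θ z t * (a θ z t)⁻¹) =ᶠ[𝓝 0] fun _ => 1 := by
            filter_upwards [(hF θ z hz).1.continuousAt.eventually_ne
              (show a θ z 0 ≠ 0 by rw [ha0 θ z hz]; exact hr')] with t ht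
            exact mul_inv_cancel₀ ht
          rw [h2.iteratedDeriv_eq, iteratedDeriv_const, if_neg (Nat.succ_ne_zero k),
            Finset.sum_range_succ'] at h1
          simp only [Nat.choose_zero_right, Nat.cast_one, one_mul, iteratedDeriv_zero,
            ha0 θ z hz, Nat.sub_zero, Nat.add_sub_add_right] at h1
          have h3 : iteratedDeriv (k + 1) (fun t => (a θ z t)⁻¹) 0 = (r : ℂ)⁻¹ *
              (r * iteratedDeriv (k + 1) (fun t => (a θ z t)⁻¹) 0) := by
            rw [inv_mul_cancel_left₀ hr']
          rw [h3, ← sub_eq_of_eq_add' h1]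
          push_cast
          simp only [mul_assoc]
          ring
  · filter_upwards [(hF θ z hz).2] with t ht
    rw [ht]
    simp

end IsLaurent

/-! ### The denominator of the recursion kernel -/

theorem iteratedDeriv_dslope {f : ℂ → ℂ} (hf : AnalyticAt ℂ f 0) (k : ℕ) :
    iteratedDeriv k (dslope f 0) 0 = iteratedDeriv (k + 1) f 0 / (k + 1) := by
  obtain ⟨p, hp⟩ := hf
  have hw : AnalyticAt ℂ (dslope f 0) 0 := ⟨_, hp.has_fpower_series_dslope_fslope⟩
  have h1 : f = fun t => f 0 + t * dslope f 0 t := by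
    funext t
    have := sub_smul_dslope f 0 t
    rw [sub_zero, smul_eq_mul] at this
    rw [this]
    ring
  have h2 : iteratedDeriv (k + 1) f 0 = (k + 1) * iteratedDeriv k (dslope f 0) 0 := by
    conv_lhs => rw [h1]
    rw [iteratedDeriv_const_add (Nat.succ_pos k), iteratedDeriv_succ_id_mul hw]
  rw [h2, mul_div_cancel_left₀ _ (Nat.cast_add_one_ne_zero k)]

section Scalar

variable {n : ℕ}

theorem isLaurent_ratCast (r : ℚ) :
    IsLaurent (∅ : Finset (Fin n)) 0 0 fun _ _ _ => (r : ℂ) := by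
  refine isLaurent_of_analytic (fun _ _ _ => analyticAt_const) fun k => ?_
  simp only [iteratedDeriv_const]
  by_cases hk : k = 0
  · simp only [if_pos hk]
    exact adm_ratCast r (by omega)
  · simp only [if_neg hk]
    exact (adm ∅ _).zero_mem

theorem isLaurent_exp (c : ℤ) :
    IsLaurent (∅ : Finset (Fin n)) 0 0 fun _ _ t => Complex.exp (c * t) := by
  refine isLaurent_of_analytic (fun _ _ _ => by fun_prop) fun k => ?_
  simp only [iteratedDeriv_cexp_const_mul]
  simpa using adm_ratCast (n := n) (w := 0 + k) ((c : ℚ) ^ k) (by simp)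

theorem isLaurent_id : IsLaurent (∅ : Finset (Fin n)) (-1) 0 fun _ _ t => t := by
  refine isLaurent_of_analytic (fun _ _ _ => analyticAt_id) fun k => ?_
  simp only [iteratedDeriv_fun_id_zero]
  by_cases hk : k = 1
  · simp only [if_pos hk]
    simpa using adm_ratCast (n := n) (w := -1 + k) 1 (by omega)
  · simp only [if_neg hk]
    exact (adm ∅ _).zero_mem

theorem isLaurent_inv_id : IsLaurent (∅ : Finset (Fin n)) 1 1 fun _ _ t => t⁻¹ := by
  refine ⟨fun _ _ _ => 1, fun k => ?_, fun θ z hz => ⟨analyticAt_const, by simp⟩⟩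
  simp only [iteratedDeriv_const]
  by_cases hk : k = 0
  · simp only [if_pos hk]
    simpa using adm_ratCast (n := n) (w := 1 - 1 + k) 1 (by omega)
  · simp only [if_neg hk]
    exact (adm ∅ _).zero_mem

/-- The entire function `(e ^ (c t) - 1) / t`. -/
noncomputable def expSlope (c : ℤ) : ℂ → ℂ := dslope (fun t => Complex.exp (c * t)) 0

theorem mul_expSlope (c : ℤ) (t : ℂ) : t * expSlope c t = Complex.exp (c * t) - 1 := by
  have := sub_smul_dslope (fun t : ℂ => Complex.exp (c * t)) 0 t
  simpa [expSlope] using this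

theorem analyticAt_expSlope (c : ℤ) : AnalyticAt ℂ (expSlope c) 0 := by
  obtain ⟨p, hp⟩ : AnalyticAt ℂ (fun t : ℂ => Complex.exp (c * t)) 0 := by fun_prop
  exact ⟨_, hp.has_fpower_series_dslope_fslope⟩

theorem expSlope_zero (c : ℤ) : expSlope c 0 = c := by
  have : HasDerivAt (fun t : ℂ => Complex.exp (c * t)) _ 0 :=
    ((hasDerivAt_id (0 : ℂ)).const_mul (c : ℂ)).cexp
  rw [expSlope, dslope_same, this.deriv]
  simp

theorem isLaurent_expSlope (c : ℤ) :
    IsLaurent (∅ : Finset (Fin n)) 0 0 fun _ _ t => expSlope c t := by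
  refine isLaurent_of_analytic (fun _ _ _ => analyticAt_expSlope c) fun k => ?_
  have : ∀ k : ℕ, iteratedDeriv k (fun t => expSlope c t) 0 =
      (((c : ℚ) ^ (k + 1) / (k + 1) : ℚ) : ℂ) := by
    intro k
    refine (iteratedDeriv_dslope (by fun_prop) k).trans ?_
    rw [iteratedDeriv_cexp_const_mul]
    simp
  simp only [this]
  exact adm_ratCast _ (by omega)

/-- The function `(p - p⁻¹) ^ 2` of the point `p = ± e ^ t`. -/
noncomputable def sqDiff (t : ℂ) : ℂ := (Complex.exp t - Complex.exp (-t)) ^ 2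

/-- The entire function `sqDiff t / t ^ 2`. -/
noncomputable def sqDiffSlope (t : ℂ) : ℂ := expSlope 2 t ^ 2 * Complex.exp (-2 * t)

theorem sqDiff_eq (t : ℂ) : sqDiff t = t ^ 2 * sqDiffSlope t := by
  have h1 : t ^ 2 * sqDiffSlope t = (t * expSlope 2 t) ^ 2 * Complex.exp (-2 * t) := by
    rw [sqDiffSlope]; ring
  rw [h1, mul_expSlope, sqDiff]
  have h2 : Complex.exp ((2 : ℤ) * t) = Complex.exp t * Complex.exp t := by
    rw [← Complex.exp_add]; congr 1; push_cast; ring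
  have h3 : Complex.exp (-2 * t) = Complex.exp (-t) * Complex.exp (-t) := by
    rw [← Complex.exp_add]; congr 1; ring
  have h4 : Complex.exp t * Complex.exp (-t) = 1 := by
    rw [← Complex.exp_add, add_neg_cancel, Complex.exp_zero]
  rw [h2, h3]
  linear_combination (-Complex.exp t *
    (Complex.exp t + Complex.exp t ^ 2 * Complex.exp (-t) - 2 * Complex.exp (-t))) * h4

theorem sqDiffSlope_zero : sqDiffSlope 0 = 4 := by
  rw [sqDiffSlope, expSlope_zero]
  norm_num

theorem analyticAt_sqDiffSlope : AnalyticAt ℂ sqDiffSlope 0 :=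
  ((analyticAt_expSlope 2).pow 2).fun_mul (by fun_prop)

theorem isLaurent_sqDiffSlope :
    IsLaurent (∅ : Finset (Fin n)) 0 0 fun _ _ t => sqDiffSlope t := by
  have h := ((isLaurent_expSlope (n := n) 2).mul_left (isLaurent_expSlope 2)).mul_left
    (isLaurent_exp (-2))
  refine h.congr fun θ z hz => Eventually.of_forall fun t => ?_
  rw [sqDiffSlope, sq]
  norm_num

theorem isLaurent_sqDiff : IsLaurent (∅ : Finset (Fin n)) (-2) 0 fun _ _ t => sqDiff t := by
  have h := ((isLaurent_id (n := n)).mul_left isLaurent_id).mul_left isLaurent_sqDiffSlope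
  refine h.congr fun θ z hz => Eventually.of_forall fun t => ?_
  rw [sqDiff_eq, sq]

theorem analyticAt_sqDiff : AnalyticAt ℂ sqDiff 0 := by
  unfold sqDiff
  fun_prop

theorem isLaurent_sqDiff_pow (j : ℕ) :
    IsLaurent (∅ : Finset (Fin n)) (-(2 * j)) 0 fun _ _ t => sqDiff t ^ j := by
  induction j with
  | zero => simpa using isLaurent_ratCast (n := n) 1
  | succ j ih =>
    refine (IsLaurent.mono ?_ (ih.mul_left isLaurent_sqDiff)).congr fun θ z hz =>
      Eventually.of_forall fun t => pow_succ _ _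
    push_cast
    omega

theorem adm_iteratedDeriv_sqDiff_pow (j k : ℕ) :
    (fun _ _ => iteratedDeriv k (fun t => sqDiff t ^ j) 0) ∈
      adm (∅ : Finset (Fin n)) (-(2 * j) + k) := by
  obtain ⟨h, h1, h2⟩ := isLaurent_sqDiff_pow (n := n) j
  refine adm_congr (by simpa using h1 k) fun θ z hz => ?_
  obtain ⟨h3, h4⟩ := h2 θ z hz
  refine EventuallyEq.iteratedDeriv_eq k ?_
  have h5 : AnalyticAt ℂ (fun t => sqDiff t ^ j) 0 := analyticAt_sqDiff.fun_pow j
  exact (h5.frequently_eq_iff_eventually_eq h3).1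
    (Eventually.frequently (by simpa using h4))

/-- The numbers `q ^ k / (1 - q ^ k) ^ 2`, whose power sums are the `q`-zeta values. -/
noncomputable def zetaRoot (θ : CurveParam) (k : Finset.Icc 1 θ.M) : ℂ :=
  θ.q ^ (k : ℕ) / (1 - θ.q ^ (k : ℕ)) ^ 2

/-- The elementary symmetric functions of the `zetaRoot`s. -/
noncomputable def zetaESymm (θ : CurveParam) (j : ℕ) : ℂ :=
  MvPolynomial.aeval (zetaRoot θ) (MvPolynomial.esymm (Finset.Icc 1 θ.M) ℂ j)

theorem zetaESymm_eq (θ : CurveParam) (j : ℕ) : zetaESymm θ j =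
    ∑ T ∈ Finset.powersetCard j Finset.univ, ∏ k ∈ T, zetaRoot θ k := by
  simp [zetaESymm, MvPolynomial.esymm]

theorem zetaESymm_eq_zero (θ : CurveParam) {j : ℕ} (hj : Fintype.card (Finset.Icc 1 θ.M) < j) :
    zetaESymm θ j = 0 := by
  rw [zetaESymm_eq, Finset.powersetCard_eq_empty.2 (by simpa using hj), Finset.sum_empty]

theorem aeval_psum_zetaRoot (θ : CurveParam) (j : ℕ) :
    MvPolynomial.aeval (zetaRoot θ) (MvPolynomial.psum (Finset.Icc 1 θ.M) ℂ j) =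
      truncatedQZeta θ.q θ.M j := by
  simp only [MvPolynomial.psum, map_sum, map_pow, MvPolynomial.aeval_X, truncatedQZeta]
  rw [← Finset.sum_coe_sort (Finset.Icc 1 θ.M)]
  refine Finset.sum_congr rfl fun k _ => ?_
  rw [zetaRoot, div_pow, ← pow_mul, ← pow_mul]

/-- By Newton's identities the `j`-th elementary symmetric function of the `zetaRoot`s is a
rational polynomial of degree `2 j` in the `q`-zeta values, which does not depend on `θ`. -/
theorem adm_zetaESymm (j : ℕ) :
    (fun θ _ => zetaESymm θ j) ∈ adm (∅ : Finset (Fin n)) (2 * j) := by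
  induction j using Nat.strong_induction_on with
  | _ j ih =>
    rcases Nat.eq_zero_or_pos j with rfl | hj
    · simpa [zetaESymm] using adm_ratCast (n := n) (w := 2 * (0 : ℕ)) 1 le_rfl
    · have key : ∀ θ : CurveParam, zetaESymm θ j = (((-1) ^ (j + 1) / j : ℚ) : ℂ) *
          ∑ a ∈ Finset.HasAntidiagonal.antidiagonal j with a.1 < j,
            (((-1) ^ a.1 : ℚ) : ℂ) * (zetaESymm θ a.1 * truncatedQZeta θ.q θ.M a.2) := by
        intro θ
        have h := congrArg (MvPolynomial.aeval (zetaRoot θ))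
          (MvPolynomial.mul_esymm_eq_sum (Finset.Icc 1 θ.M) ℂ j)
        simp only [map_mul, map_sum, map_pow, map_neg, map_one, map_natCast,
          aeval_psum_zetaRoot] at h
        have hj' : (j : ℂ) ≠ 0 := Nat.cast_ne_zero.2 hj.ne'
        have h' : zetaESymm θ j = (j : ℂ)⁻¹ * (j * zetaESymm θ j) := by
          rw [inv_mul_cancel_left₀ hj']
        rw [h', zetaESymm, h, ← mul_assoc]
        push_cast
        congr 1
        · ring
        · refine Finset.sum_congr rfl fun a _ => ?_
          rw [mul_assoc]
          rfl
      refine adm_congr (adm_ratCast_mul _ (adm_sum _ fun a ha => adm_ratCast_mul _ ?_))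
        fun θ z _ => key θ
      rw [Finset.mem_filter, Finset.HasAntidiagonal.mem_antidiagonal] at ha
      have hz := adm_zeta (n := n) ⟨a.2, by omega⟩
      refine adm_mono ?_ (adm_mul_left (ih a.1 ha.2) hz)
      simp only [PNat.mk_coe]
      omega

/-- The product `∏ k, (1 - q ^ k p²) (1 - q ^ k p⁻²) / (1 - q ^ k)²` at the point `p = ± e ^ t`. -/
noncomputable def curveProd (θ : CurveParam) (t : ℂ) : ℂ :=
  ∏ k : Finset.Icc 1 θ.M, (1 - zetaRoot θ k * sqDiff t)

theorem curveProd_eq (θ : CurveParam) (t : ℂ) : curveProd θ t =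
    ∑ j ∈ Finset.range (Fintype.card (Finset.Icc 1 θ.M) + 1),
      ((-1) ^ j * zetaESymm θ j) * sqDiff t ^ j := by
  simp only [curveProd, sub_eq_add_neg]
  rw [Finset.prod_one_add, Finset.sum_powerset, Finset.card_univ]
  refine Finset.sum_congr rfl fun j _ => ?_
  rw [zetaESymm_eq, Finset.mul_sum, Finset.sum_mul]
  refine Finset.sum_congr rfl fun T hT => ?_
  rw [Finset.mem_powersetCard_univ] at hT
  rw [← hT, mul_right_comm, ← mul_pow, neg_one_mul, ← Finset.prod_const, ← Finset.prod_mul_distrib]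
  exact Finset.prod_congr rfl fun k _ => by ring

theorem analyticAt_curveProd (θ : CurveParam) : AnalyticAt ℂ (curveProd θ) 0 := by
  unfold curveProd
  exact Finset.analyticAt_fun_prod _ fun k _ =>
    analyticAt_const.fun_sub (analyticAt_const.fun_mul analyticAt_sqDiff)

theorem curveProd_zero (θ : CurveParam) : curveProd θ 0 = 1 := by
  simp [curveProd, sqDiff]

theorem isLaurent_curveProd :
    IsLaurent (∅ : Finset (Fin n)) 0 0 fun θ _ t => curveProd θ t := by
  refine isLaurent_of_analytic (fun θ _ _ => analyticAt_curveProd θ) fun k => ?_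
  refine adm_congr (adm_sum (Finset.range (k + 1)) fun j _ => adm_ratCast_mul ((-1) ^ j)
    (adm_mono (by omega) (adm_mul_left (adm_zetaESymm j) (adm_iteratedDeriv_sqDiff_pow j k))))
    fun θ z hz => ?_
  have h1 : iteratedDeriv k (fun t => curveProd θ t) 0 =
      ∑ j ∈ Finset.range (Fintype.card (Finset.Icc 1 θ.M) + 1),
        ((-1) ^ j * zetaESymm θ j) * iteratedDeriv k (fun t => sqDiff t ^ j) 0 := by
    simp only [curveProd_eq]
    rw [iteratedDeriv_fun_sum fun j _ =>
      (analyticAt_const.fun_mul (analyticAt_sqDiff.fun_pow j)).contDiffAt]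
    exact Finset.sum_congr rfl fun j _ => iteratedDeriv_const_mul_field _ _
  -- Both sums may be extended: `zetaESymm θ j` vanishes for `j > M`, the derivative for `2 j > k`.
  have h2 : ∀ a b : ℕ, (∀ j, a ≤ j → zetaESymm θ j *
        iteratedDeriv k (fun t => sqDiff t ^ j) 0 = 0) →
      ∑ j ∈ Finset.range a, ((-1) ^ j * zetaESymm θ j) *
        iteratedDeriv k (fun t => sqDiff t ^ j) 0 =
      ∑ j ∈ Finset.range (a + b), ((-1) ^ j * zetaESymm θ j) *
        iteratedDeriv k (fun t => sqDiff t ^ j) 0 := by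
    intro a b hab
    refine Finset.sum_subset (Finset.range_mono (Nat.le_add_right a b)) fun j _ hj => ?_
    rw [mul_assoc, hab j (by simpa using hj), mul_zero]
  rw [h1, h2 _ (k + 1) fun j hj => by rw [zetaESymm_eq_zero θ (by omega), zero_mul], add_comm,
    ← h2]
  · refine Finset.sum_congr rfl fun j _ => ?_
    push_cast
    ring
  · intro j hj
    rw [eq_zero_of_adm_neg (by omega) (adm_iteratedDeriv_sqDiff_pow j k) θ hz, mul_zero]

/-- The inverse of the denominator of the recursion kernel. -/
theorem isLaurent_inv_sqDiff_mul_curveProd :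
    IsLaurent (∅ : Finset (Fin n)) 2 2 fun θ _ t => (sqDiff t * curveProd θ t)⁻¹ := by
  have h1 := (isLaurent_inv_id (n := n)).mul_left isLaurent_inv_id
  have h2 := (isLaurent_sqDiffSlope (n := n)).mul_left isLaurent_curveProd
  have h3 := h2.inv (r := 4) (by norm_num) fun θ z hz => by
    have h4 : ContinuousAt (fun t => sqDiffSlope t * curveProd θ t) 0 :=
      analyticAt_sqDiffSlope.continuousAt.mul (analyticAt_curveProd θ).continuousAt
    have h5 := h4.tendsto.mono_left (nhdsWithin_le_nhds (s := {0}ᶜ))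
    simpa [sqDiffSlope_zero, curveProd_zero] using h5
  refine (h1.mul_left h3).congr fun θ z hz => Eventually.of_forall fun t => ?_
  rw [sqDiff_eq, sq]
  simp only [mul_inv]
  ring

end Scalar

/-! ### Local expansions of the differentials -/

theorem tendsto_neg_nhdsNE_zero : Tendsto (fun t : ℂ => -t) (𝓝[≠] 0) (𝓝[≠] 0) := by
  refine tendsto_nhdsWithin_of_tendsto_nhds_of_eventually_within _ ?_ ?_
  · have : Tendsto (fun t : ℂ => -t) (𝓝 0) (𝓝 (-0)) := continuous_neg.tendsto 0
    rw [neg_zero] at this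
    exact this.mono_left nhdsWithin_le_nhds
  · filter_upwards [self_mem_nhdsWithin] with t ht
    exact neg_ne_zero.2 ht

theorem eventually_exp_mul_two_ne_one : ∀ᶠ t in 𝓝[≠] (0 : ℂ), Complex.exp (2 * t) ≠ 1 := by
  have : HasDerivAt (fun t : ℂ => Complex.exp (2 * t)) _ 0 :=
    ((hasDerivAt_id (0 : ℂ)).const_mul 2).cexp
  exact this.eventually_ne (by simp)

theorem sq_sgn_mul_exp (α : ℤˣ) (t : ℂ) : (sgn α * Complex.exp t) ^ 2 = Complex.exp (2 * t) := by
  rw [mul_pow, sgn_sq, one_mul, ← Complex.exp_nat_mul]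
  norm_num

theorem eventually_sgn_mul_exp_ne (α : ℤˣ) :
    ∀ᶠ t in 𝓝[≠] (0 : ℂ), sgn α * Complex.exp t ≠ 1 ∧ sgn α * Complex.exp t ≠ -1 := by
  filter_upwards [eventually_exp_mul_two_ne_one] with t ht
  rw [← sq_sgn_mul_exp α] at ht
  constructor <;> intro h <;> rw [h] at ht <;> norm_num at ht

theorem inv_sgn_mul_exp (α : ℤˣ) (t : ℂ) :
    (sgn α * Complex.exp t)⁻¹ = sgn α * Complex.exp (-t) := by
  rw [mul_inv, sgn_inv, Complex.exp_neg]

theorem sgn_mul (α β : ℤˣ) : sgn (α * β) = sgn α * sgn β := by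
  simp [sgn]

/-- In the coordinate `t` at the branch point `α`, the differential `xi β d` is a derivative of a
fixed function of `t`. -/
theorem mul_xi_eq (α β : ℤˣ) (d : ℕ) (t : ℂ) :
    sgn α * Complex.exp t * xi β d (sgn α * Complex.exp t) =
      iteratedDeriv (2 * d + 1) (chi (α * β) 1) t := by
  have h : (fun τ => sgn α * Complex.exp t * chi β (sgn α * Complex.exp t) τ) =
      fun τ => chi (α * β) 1 (t + τ) := by
    funext τ
    simp only [chi, Complex.exp_add, sgn_mul, mul_div_assoc']
    congr 1 <;> ring
  rw [xi, ← iteratedDeriv_const_mul_field, h, iteratedDeriv_comp_const_add]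
  simp

/-- The expansion of `p / (1 - p)` at `p = ± e ^ t`: it has a simple pole for the sign `+` and none
for the sign `-`. -/
theorem isLaurent_chi_one {n : ℕ} (γ : ℤˣ) :
    IsLaurent (∅ : Finset (Fin n)) 1 1 fun _ _ t => chi γ 1 t := by
  rcases Int.units_eq_one_or γ with rfl | rfl
  · have h1 := (isLaurent_expSlope (n := n) 1).inv (r := 1) one_ne_zero fun θ z hz => by
      have := (analyticAt_expSlope 1).continuousAt.tendsto.mono_left
        (nhdsWithin_le_nhds (s := {0}ᶜ))
      simpa [expSlope_zero] using this
    have h2 := ((isLaurent_ratCast (n := n) (-1)).mul_left (isLaurent_exp 1)).mul_left h1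
    refine ((isLaurent_inv_id (n := n)).mul_left h2).congr fun θ z hz => ?_
    filter_upwards [self_mem_nhdsWithin] with t ht
    have h3 := mul_expSlope 1 t
    have h4 : 1 - Complex.exp t = -(t * expSlope 1 t) := by
      rw [h3]; simp
    simp only [chi, sgn, Units.val_one, Int.cast_one, one_mul, mul_one, h4]
    push_cast
    rw [div_neg, div_eq_mul_inv, mul_inv]
    ring
  · have h1 := (isLaurent_ratCast (n := n) 1).add (isLaurent_exp 1)
    have h2 := h1.inv (r := 2) two_ne_zero fun θ z hz => by
      have h3 : ContinuousAt (fun t : ℂ => ((1 : ℚ) : ℂ) + Complex.exp ((1 : ℤ) * t)) 0 := by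
        fun_prop
      have := h3.tendsto.mono_left (nhdsWithin_le_nhds (s := {0}ᶜ))
      norm_num at this
      simpa using this
    have h3 := ((isLaurent_ratCast (n := n) (-1)).mul_left (isLaurent_exp 1)).mul_left h2
    refine ((IsLaurent.mono_order (K := 1) (by norm_num) h3).mono (v := 1) (by norm_num)).congr
      fun θ z hz => Eventually.of_forall fun t => ?_
    simp [chi, sgn, div_eq_mul_inv]

theorem isLaurent_iteratedDeriv_chi_one {n : ℕ} (γ : ℤˣ) (m : ℕ) :
    IsLaurent (∅ : Finset (Fin n)) (m + 1) (m + 1) fun _ _ t => iteratedDeriv m (chi γ 1) t := by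
  induction m with
  | zero => simpa using isLaurent_chi_one γ
  | succ m ih =>
    simp only [iteratedDeriv_succ]
    exact_mod_cast ih.deriv

theorem chi_one_neg (γ : ℤˣ) {t : ℂ} (ht : sgn γ * Complex.exp t ≠ 1) :
    chi γ 1 (-t) = -1 - chi γ 1 t := by
  have h1 : 1 - sgn γ * Complex.exp t ≠ 0 := sub_ne_zero.2 ht.symm
  have h2 : 1 - (sgn γ * Complex.exp t)⁻¹ ≠ 0 := by
    rw [sub_ne_zero]
    intro h
    exact ht (inv_eq_one.1 h.symm)
  have h0 : sgn γ * Complex.exp t ≠ 0 := mul_ne_zero (sgn_ne_zero γ) (Complex.exp_ne_zero t)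
  simp only [chi, ← inv_sgn_mul_exp, mul_one]
  generalize sgn γ * Complex.exp t = p at h0 h1 h2
  rw [div_eq_iff h2]
  field_simp
  ring

/-- The odd derivatives of `chi γ 1` are even. -/
theorem iteratedDeriv_chi_one_neg (γ : ℤˣ) (d : ℕ) {t : ℂ} (ht : sgn γ * Complex.exp t ≠ 1) :
    iteratedDeriv (2 * d + 1) (chi γ 1) (-t) = iteratedDeriv (2 * d + 1) (chi γ 1) t := by
  have h1 := iteratedDeriv_comp_neg (2 * d + 1) (chi γ 1) t
  have h2 : (fun u => chi γ 1 (-u)) =ᶠ[𝓝 t] fun u => -1 - chi γ 1 u := by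
    have : ContinuousAt (fun u => sgn γ * Complex.exp u) t := by fun_prop
    filter_upwards [this.eventually_ne ht] with u hu
    exact chi_one_neg γ hu
  rw [h2.iteratedDeriv_eq, iteratedDeriv_const_sub (Nat.succ_pos _), iteratedDeriv_neg,
    Odd.neg_one_pow ⟨d, rfl⟩, neg_one_smul] at h1
  exact (neg_injective h1).symm

/-- The function `p f(p, z')` of `t`, where `p = α e ^ t` and `z'` consists of the coordinates of `z`
picked out by `e`; the factor `p` comes from `dp = p dt`. -/
noncomputable def slotOne {n k : ℕ} (α : ℤˣ) (e : Fin k ↪ Fin n)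
    (f : CurveParam → (Fin (k + 1) → ℂ) → ℂ) (θ : CurveParam) (z : Fin n → ℂ) (t : ℂ) : ℂ :=
  sgn α * Complex.exp t * f θ (Fin.cons (sgn α * Complex.exp t) (z ∘ e))

theorem cons_mem_offBranch {k : ℕ} {p : ℂ} {z : Fin k → ℂ} (hp : p ≠ 1 ∧ p ≠ -1)
    (hz : z ∈ offBranch k) : (Fin.cons p z : Fin (k + 1) → ℂ) ∈ offBranch (k + 1) := by
  intro i
  refine Fin.cases ?_ (fun j => ?_) i
  · simpa using hp
  · simpa using hz j

theorem comp_mem_offBranch {n k : ℕ} (e : Fin k ↪ Fin n) {z : Fin n → ℂ} (hz : z ∈ offBranch n) :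
    z ∘ e ∈ offBranch k := fun i => hz (e i)

theorem adm_prod_map {n k : ℕ} (e : Fin k ↪ Fin n) (μ : ℕ+ →₀ ℕ) (β : Fin k → ℤˣ)
    (d : Fin k → ℕ) :
    (fun θ z => zetaMonomial θ μ * ∏ j, xi (β j) (d j) (z (e j))) ∈
      adm (Finset.univ.map e) (zetaWeight μ + 2 * ∑ j, (d j : ℤ)) := by
  refine adm_of_gen ⟨μ, Function.extend e β 1, Function.extend e d 0, ?_, ?_⟩
  · simp [Finset.sum_map, e.injective.extend_apply]
  · simp [Finset.prod_map, e.injective.extend_apply]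

/-- An admissible function as a function of its first argument near a branch point: all the `xi β d`
are invariant up to sign under `p ↦ p⁻¹`, whence the evenness in `t`. -/
theorem isLaurent_slotOne {n k : ℕ} (α : ℤˣ) (e : Fin k ↪ Fin n) {w : ℤ}
    {f : CurveParam → (Fin (k + 1) → ℂ) → ℂ} (hf : f ∈ adm Finset.univ w) :
    (∃ N, IsLaurent (Finset.univ.map e) (w + 2) N (slotOne α e f)) ∧
    ∀ θ, ∀ z ∈ offBranch n, ∀ᶠ t in 𝓝[≠] 0, slotOne α e f θ z (-t) = slotOne α e f θ z t := by
  obtain ⟨c, hc, hfc⟩ := hf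
  have hcongr : ∀ θ, ∀ z ∈ offBranch n,
      ∀ᶠ t in 𝓝[≠] 0, slotOne α e f θ z t = slotOne α e c θ z t := by
    intro θ z hz
    filter_upwards [eventually_sgn_mul_exp_ne α] with t ht
    rw [slotOne, slotOne, hfc θ _ (cons_mem_offBranch ht (comp_mem_offBranch e hz))]
  suffices H : (∃ N, IsLaurent (Finset.univ.map e) (w + 2) N (slotOne α e c)) ∧
      ∀ θ, ∀ z ∈ offBranch n, ∀ᶠ t in 𝓝[≠] 0,
        slotOne α e c θ z (-t) = slotOne α e c θ z t by
    obtain ⟨⟨N, hN⟩, heven⟩ := H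
    refine ⟨⟨N, hN.congr hcongr⟩, fun θ z hz => ?_⟩
    filter_upwards [hcongr θ z hz, tendsto_neg_nhdsNE_zero.eventually (hcongr θ z hz),
      heven θ z hz] with t h1 h2 h3
    rw [h1, h2, h3]
  clear hcongr hfc
  induction hc using Submodule.span_induction with
  | mem f hf =>
    obtain ⟨μ, β, d, hw, rfl⟩ := hf
    have hval : ∀ θ z t, slotOne α e (fun θ z => zetaMonomial θ μ *
        ∏ i, xi (β i) (d i) (z i)) θ z t =
        (zetaMonomial θ μ * ∏ j : Fin k, xi (β j.succ) (d j.succ) (z (e j))) *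
          iteratedDeriv (2 * d 0 + 1) (chi (α * β 0) 1) t := by
      intro θ z t
      rw [slotOne, Fin.prod_univ_succ, ← mul_xi_eq]
      simp only [Fin.cons_zero, Fin.cons_succ, Function.comp_apply]
      ring
    constructor
    · refine ⟨2 * d 0 + 1 + 1, ?_⟩
      have h1 := IsLaurent.const_mul (adm_prod_map e μ (fun j => β j.succ) fun j => d j.succ)
        (Finset.disjoint_empty_right _) (isLaurent_iteratedDeriv_chi_one (α * β 0) (2 * d 0 + 1))
      rw [Finset.union_empty] at h1
      refine (h1.mono ?_).congr fun θ z hz => Eventually.of_forall fun t => hval θ z t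
      rw [Fin.sum_univ_succ] at hw
      push_cast
      linarith
    · intro θ z hz
      filter_upwards [eventually_sgn_mul_exp_ne (α * β 0)] with t ht
      rw [hval, hval, iteratedDeriv_chi_one_neg _ _ ht.1]
  | zero =>
    refine ⟨⟨0, ?_⟩, fun θ z hz => by simp [slotOne]⟩
    have := IsLaurent.const_mul (adm (Finset.univ.map e) (w + 2)).zero_mem
      (Finset.disjoint_empty_right _) (isLaurent_ratCast (n := n) 0)
    rw [Finset.union_empty, add_zero] at this
    refine this.congr fun θ z hz => Eventually.of_forall fun t => ?_
    simp [slotOne]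
  | add x y _ _ hx hy =>
    obtain ⟨⟨N, hN⟩, hxe⟩ := hx
    obtain ⟨⟨K, hK⟩, hye⟩ := hy
    refine ⟨⟨max N K, ((hN.mono_order (le_max_left N K)).add
      (hK.mono_order (le_max_right N K))).congr fun θ z hz => Eventually.of_forall fun t => ?_⟩,
      fun θ z hz => ?_⟩
    · simp [slotOne, mul_add]
    · filter_upwards [hxe θ z hz, hye θ z hz] with t h1 h2
      simp only [slotOne, Pi.add_apply, mul_add] at h1 h2 ⊢
      rw [h1, h2]
  | smul r x _ hx =>
    obtain ⟨⟨N, hN⟩, hxe⟩ := hx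
    have hval : ∀ θ z t, slotOne α e (r • x) θ z t = (r : ℂ) * slotOne α e x θ z t := by
      intro θ z t
      simp only [slotOne, Pi.smul_apply, Rat.smul_def]
      ring
    refine ⟨⟨N, (hN.ratCast_mul r).congr fun θ z hz => Eventually.of_forall fun t => hval θ z t⟩,
      fun θ z hz => ?_⟩
    filter_upwards [hxe θ z hz] with t h1
    rw [hval, hval, h1]

/-- The function `f(p, p⁻¹, z')` of `t`, the analogue of `slotOne` for two arguments; the two factors
`p` and `p⁻¹` cancel. -/
noncomputable def slotTwo {n k : ℕ} (α : ℤˣ) (e : Fin k ↪ Fin n)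
    (f : CurveParam → (Fin (k + 2) → ℂ) → ℂ) (θ : CurveParam) (z : Fin n → ℂ) (t : ℂ) : ℂ :=
  f θ (Fin.cons (sgn α * Complex.exp t) (Fin.cons (sgn α * Complex.exp t)⁻¹ (z ∘ e)))

theorem isLaurent_slotTwo {n k : ℕ} (α : ℤˣ) (e : Fin k ↪ Fin n) {w : ℤ}
    {f : CurveParam → (Fin (k + 2) → ℂ) → ℂ} (hf : f ∈ adm Finset.univ w) :
    ∃ N, IsLaurent (Finset.univ.map e) (w + 4) N (slotTwo α e f) := by
  obtain ⟨c, hc, hfc⟩ := hf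
  have hcongr : ∀ θ, ∀ z ∈ offBranch n,
      ∀ᶠ t in 𝓝[≠] 0, slotTwo α e f θ z t = slotTwo α e c θ z t := by
    intro θ z hz
    filter_upwards [eventually_sgn_mul_exp_ne α,
      tendsto_neg_nhdsNE_zero.eventually (eventually_sgn_mul_exp_ne α)] with t ht ht'
    rw [← inv_sgn_mul_exp] at ht'
    rw [slotTwo, slotTwo, hfc θ _ (cons_mem_offBranch ht (cons_mem_offBranch ht'
      (comp_mem_offBranch e hz)))]
  suffices H : ∃ N, IsLaurent (Finset.univ.map e) (w + 4) N (slotTwo α e c) by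
    obtain ⟨N, hN⟩ := H
    exact ⟨N, hN.congr hcongr⟩
  clear hcongr hfc
  induction hc using Submodule.span_induction with
  | mem f hf =>
    obtain ⟨μ, β, d, hw, rfl⟩ := hf
    have h1 := (isLaurent_iteratedDeriv_chi_one (n := n) (α * β 0) (2 * d 0 + 1)).mul_left
      (isLaurent_iteratedDeriv_chi_one (α * β 1) (2 * d 1 + 1))
    have h2 := IsLaurent.const_mul (adm_prod_map e μ (fun j => β j.succ.succ)
      fun j => d j.succ.succ) (Finset.disjoint_empty_right _) h1
    rw [Finset.union_empty] at h2
    refine ⟨_, (h2.mono ?_).congr fun θ z hz => ?_⟩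
    · rw [Fin.sum_univ_succ, Fin.sum_univ_succ, Fin.succ_zero_eq_one] at hw
      push_cast
      linarith
    · filter_upwards [eventually_sgn_mul_exp_ne (α * β 1)] with t ht
      rw [slotTwo, Fin.prod_univ_succ, Fin.prod_univ_succ, ← mul_xi_eq,
        ← iteratedDeriv_chi_one_neg _ _ ht.1, ← mul_xi_eq, ← inv_sgn_mul_exp]
      simp only [Fin.cons_zero, Fin.cons_succ, Function.comp_apply]
      simp only [Fin.succ_zero_eq_one]
      have h0 : sgn α * Complex.exp t ≠ 0 := mul_ne_zero (sgn_ne_zero α) (Complex.exp_ne_zero t)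
      generalize sgn α * Complex.exp t = p at h0 ⊢
      field_simp
  | zero =>
    refine ⟨0, ?_⟩
    have := IsLaurent.const_mul (adm (Finset.univ.map e) (w + 4)).zero_mem
      (Finset.disjoint_empty_right _) (isLaurent_ratCast (n := n) 0)
    rw [Finset.union_empty, add_zero] at this
    refine this.congr fun θ z hz => Eventually.of_forall fun t => ?_
    simp [slotTwo]
  | add x y _ _ hx hy =>
    obtain ⟨N, hN⟩ := hx
    obtain ⟨K, hK⟩ := hy
    exact ⟨max N K, ((hN.mono_order (le_max_left N K)).add
      (hK.mono_order (le_max_right N K))).congr fun θ z hz => Eventually.of_forall fun t => rfl⟩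
  | smul r x _ hx =>
    obtain ⟨N, hN⟩ := hx
    refine ⟨N, (hN.ratCast_mul r).congr fun θ z hz => Eventually.of_forall fun t => ?_⟩
    simp only [slotTwo, Pi.smul_apply, Rat.smul_def]

theorem analyticAt_chi {β : ℤˣ} {z : ℂ} (hz : z ≠ 1 ∧ z ≠ -1) : AnalyticAt ℂ (chi β z) 0 := by
  unfold chi
  refine AnalyticAt.div (by fun_prop) (by fun_prop) ?_
  rcases Int.units_eq_one_or β with rfl | rfl
  · simpa [sgn, sub_eq_zero] using hz.1.symm
  · simp only [sgn, Units.val_neg, Units.val_one, Int.cast_neg, Int.cast_one, Complex.exp_zero,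
      mul_one, neg_one_mul, sub_neg_eq_add]
    intro h
    exact hz.2 (by linear_combination h)

/-- The numerator `(z₁ - p⁻¹)⁻¹ - (z₁ - p)⁻¹` of the recursion kernel at `p = α e ^ t`. -/
noncomputable def kernelNum (α : ℤˣ) (z t : ℂ) : ℂ :=
  (z - sgn α * Complex.exp (-t))⁻¹ - (z - sgn α * Complex.exp t)⁻¹

theorem inv_sub_eq_neg_chi (α : ℤˣ) (z t : ℂ) :
    (z - sgn α * Complex.exp (-t))⁻¹ = -chi α z t := by
  have h : sgn α * Complex.exp (-t) = (sgn α * Complex.exp t)⁻¹ := (inv_sgn_mul_exp α t).symm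
  have h0 : sgn α * Complex.exp t ≠ 0 := mul_ne_zero (sgn_ne_zero α) (Complex.exp_ne_zero t)
  rw [h, chi]
  generalize sgn α * Complex.exp t = p at h0
  have : z - p⁻¹ = -((1 - p * z) / p) := by field_simp; ring
  rw [this, inv_neg, inv_div]

theorem kernelNum_eq (α : ℤˣ) (z t : ℂ) : kernelNum α z t = chi α z (-t) - chi α z t := by
  have h := inv_sub_eq_neg_chi α z (-t)
  rw [neg_neg] at h
  rw [kernelNum, inv_sub_eq_neg_chi, h]
  ring

theorem iteratedDeriv_kernelNum {α : ℤˣ} {z : ℂ} (hz : z ≠ 1 ∧ z ≠ -1) (k : ℕ) :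
    iteratedDeriv k (kernelNum α z) 0 = ((-1) ^ k - 1) * iteratedDeriv k (chi α z) 0 := by
  have h1 : kernelNum α z = fun t => chi α z (-t) - chi α z t := funext (kernelNum_eq α z)
  have h2 := analyticAt_chi (β := α) hz
  have h3 : AnalyticAt ℂ (fun t => chi α z (-t)) 0 :=
    AnalyticAt.fun_comp (g := chi α z) (by simpa using h2) (by fun_prop)
  rw [h1, iteratedDeriv_fun_sub h3.contDiffAt h2.contDiffAt, iteratedDeriv_comp_neg, neg_zero,
    smul_eq_mul]
  ring

theorem analyticAt_kernelNum {α : ℤˣ} {z : ℂ} (hz : z ≠ 1 ∧ z ≠ -1) :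
    AnalyticAt ℂ (kernelNum α z) 0 := by
  have h2 := analyticAt_chi (β := α) hz
  have h1 : kernelNum α z = fun t => chi α z (-t) - chi α z t := funext (kernelNum_eq α z)
  rw [h1]
  exact (AnalyticAt.fun_comp (g := chi α z) (by simpa using h2) (by fun_prop)).fun_sub h2

theorem isLaurent_kernelNum {n : ℕ} (α : ℤˣ) (i : Fin n) :
    IsLaurent {i} (-1) 0 fun _ z t => kernelNum α (z i) t := by
  refine isLaurent_of_analytic (fun θ z hz => analyticAt_kernelNum (hz i)) fun k => ?_
  have h : ∀ z ∈ offBranch n, iteratedDeriv k (fun t => kernelNum α (z i) t) 0 = _ :=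
    fun z hz => iteratedDeriv_kernelNum (α := α) (hz i) k
  rcases Nat.even_or_odd' k with ⟨j, rfl | rfl⟩
  · refine adm_congr (adm {i} _).zero_mem fun θ z hz => ?_
    rw [h z hz]
    simp
  · refine adm_congr (adm_ratCast_mul (-2) (adm_mono ?_ (adm_xi i α j))) fun θ z hz => ?_
    · push_cast
      omega
    · rw [h z hz, xi, Odd.neg_one_pow ⟨j, rfl⟩]
      push_cast
      ring

/-- The bidifferential `B(p, z)` at `p = α e ^ t`, divided by `dt dz`. -/
noncomputable def bidiff (α : ℤˣ) (z t : ℂ) : ℂ :=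
  sgn α * Complex.exp t / (sgn α * Complex.exp t - z) ^ 2

/-- Up to `t ↦ -t` the function `bidiff α z` is a derivative of `chi α z`, so that its even Taylor
coefficients are odd ones of `chi α z`, which are the `xi α d z`. -/
theorem bidiff_neg_eq_deriv (α : ℤˣ) {z t : ℂ} (h : 1 - sgn α * Complex.exp t * z ≠ 0) :
    bidiff α z (-t) = deriv (chi α z) t := by
  have h0 : sgn α * Complex.exp t ≠ 0 := mul_ne_zero (sgn_ne_zero α) (Complex.exp_ne_zero t)
  have hd : HasDerivAt (fun t => sgn α * Complex.exp t) (sgn α * Complex.exp t) t :=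
    (Complex.hasDerivAt_exp t).const_mul _
  have hd2 : HasDerivAt (chi α z) _ t := hd.div ((hd.mul_const z).const_sub 1) h
  rw [hd2.deriv, bidiff, ← inv_sgn_mul_exp]
  generalize sgn α * Complex.exp t = p at h h0
  have : p⁻¹ - z = (1 - p * z) / p := by field_simp
  rw [this]
  field_simp
  ring

theorem analyticAt_bidiff {α : ℤˣ} {z : ℂ} (hz : z ≠ 1 ∧ z ≠ -1) :
    AnalyticAt ℂ (bidiff α z) 0 := by
  unfold bidiff
  refine AnalyticAt.div (by fun_prop) (by fun_prop) (pow_ne_zero 2 ?_)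
  rcases Int.units_eq_one_or α with rfl | rfl
  · simpa [sgn, sub_eq_zero] using hz.1.symm
  · simpa [sgn, sub_eq_zero] using hz.2.symm

theorem iteratedDeriv_bidiff_neg {α : ℤˣ} {z : ℂ} (hz : z ≠ 1 ∧ z ≠ -1) (k : ℕ) :
    iteratedDeriv k (fun t => bidiff α z (-t)) 0 = iteratedDeriv (k + 1) (chi α z) 0 := by
  rw [iteratedDeriv_succ']
  refine EventuallyEq.iteratedDeriv_eq k ?_
  have h1 : 1 - sgn α * Complex.exp 0 * z ≠ 0 := by
    rcases Int.units_eq_one_or α with rfl | rfl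
    · simpa [sgn, sub_eq_zero] using hz.1.symm
    · simp only [sgn, Units.val_neg, Units.val_one, Int.cast_neg, Int.cast_one, Complex.exp_zero,
        mul_one, neg_one_mul, sub_neg_eq_add]
      intro h
      exact hz.2 (by linear_combination h)
  have : ContinuousAt (fun t => 1 - sgn α * Complex.exp t * z) 0 := by fun_prop
  filter_upwards [this.eventually_ne h1] with t ht
  exact bidiff_neg_eq_deriv α ht

/-- The part of `bidiff α z` that is even in `t`. -/
noncomputable def bidiffEven (α : ℤˣ) (z t : ℂ) : ℂ := (bidiff α z t + bidiff α z (-t)) / 2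

theorem isLaurent_bidiffEven {n : ℕ} (α : ℤˣ) (i : Fin n) :
    IsLaurent {i} 0 0 fun _ z t => bidiffEven α (z i) t := by
  have hneg : ∀ z ∈ offBranch n, AnalyticAt ℂ (fun t => bidiff α (z i) (-t)) 0 := fun z hz =>
    AnalyticAt.fun_comp (g := bidiff α (z i)) (by simpa using analyticAt_bidiff (hz i))
      (by fun_prop)
  have han : ∀ z ∈ offBranch n, AnalyticAt ℂ (fun t => bidiffEven α (z i) t) 0 := fun z hz =>
    ((analyticAt_bidiff (hz i)).fun_add (hneg z hz)).fun_div analyticAt_const two_ne_zero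
  refine isLaurent_of_analytic (fun θ z hz => han z hz) fun k => ?_
  have h : ∀ z ∈ offBranch n, iteratedDeriv k (fun t => bidiffEven α (z i) t) 0 =
      ((-1) ^ k + 1) / 2 * iteratedDeriv (k + 1) (chi α (z i)) 0 := by
    intro z hz
    have h1 := iteratedDeriv_bidiff_neg (α := α) (hz i) k
    have h2 := iteratedDeriv_comp_neg k (fun t => bidiff α (z i) (-t)) 0
    simp only [neg_neg, neg_zero, h1, smul_eq_mul] at h2
    simp only [bidiffEven]
    rw [iteratedDeriv_div_const,
      iteratedDeriv_fun_add (analyticAt_bidiff (hz i)).contDiffAt (hneg z hz).contDiffAt, h1, h2]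
    ring
  rcases Nat.even_or_odd' k with ⟨j, rfl | rfl⟩
  · refine adm_congr (adm_mono ?_ (adm_xi i α j)) fun θ z hz => ?_
    · push_cast
      omega
    · rw [h z hz, xi]
      simp
  · refine adm_congr (adm {i} _).zero_mem fun θ z hz => ?_
    rw [h z hz, Odd.neg_one_pow ⟨j, rfl⟩]
    simp

/-! ### The recursion -/

theorem IsLaurent.meromorphicAt {n : ℕ} {S : Finset (Fin n)} {w : ℤ} {N : ℕ}
    {F : CurveParam → (Fin n → ℂ) → ℂ → ℂ} (hF : IsLaurent S w N F) (θ : CurveParam)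
    {z : Fin n → ℂ} (hz : z ∈ offBranch n) : MeromorphicAt (F θ z) 0 := by
  obtain ⟨h, -, hF⟩ := hF
  refine MeromorphicAt.congr (f := fun t => h θ z t / t ^ N) ?_
    ((hF θ z hz).2.mono fun t ht => ht.symm)
  exact (hF θ z hz).1.meromorphicAt.fun_div (by fun_prop)

/-- An even function of `t` has no residue. -/
theorem hasResidueAt_zero_of_even {f G : ℂ → ℂ} (α : ℤˣ) (hG : MeromorphicAt G 0)
    (heven : ∀ᶠ t in 𝓝[≠] 0, G (-t) = G t)
    (hf : ∀ᶠ t in 𝓝[≠] (0 : ℂ),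
      f (sgn α * Complex.exp t) * (sgn α * Complex.exp t) = G t) :
    HasResidueAt f (sgn α) 0 := by
  obtain ⟨N, hN⟩ := hG
  set h : ℂ → ℂ := fun t => t ^ (N + 1) * G t with hh
  have hha : AnalyticAt ℂ h 0 := by
    have : h = fun t => t * ((t - 0) ^ N • G t) := by
      funext t
      simp only [hh, sub_zero, smul_eq_mul]
      ring
    rw [this]
    exact analyticAt_id.fun_mul hN
  have key := hasResidueAt_of_exp (f := f) (sgn_sq α) (N := N) hha (by
    filter_upwards [hf, self_mem_nhdsWithin] with t ht ht0
    rw [ht, hh, mul_div_cancel_left₀ _ (pow_ne_zero _ ht0)])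
  have hneg : AnalyticAt ℂ (fun t => h (-t)) 0 :=
    AnalyticAt.fun_comp (g := h) (by simpa using hha) (by fun_prop)
  have h1 : (fun t => h (-t)) =ᶠ[𝓝 0] fun t => (-1) ^ (N + 1) * h t := by
    refine (hneg.frequently_eq_iff_eventually_eq (analyticAt_const.fun_mul hha)).1
      (Eventually.frequently ?_)
    filter_upwards [heven] with t ht
    simp only [hh, ht, neg_pow t]
    ring
  have h2 := h1.iteratedDeriv_eq N
  rw [iteratedDeriv_comp_neg, iteratedDeriv_const_mul_field, neg_zero, smul_eq_mul, pow_succ,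
    mul_assoc, mul_right_inj' (pow_ne_zero N (neg_ne_zero.2 one_ne_zero)), neg_one_mul] at h2
  have h3 : iteratedDeriv N h 0 = 0 := self_eq_neg.1 h2
  rwa [h3, zero_div] at key

theorem IsLaurent.exists_residue {n : ℕ} {S : Finset (Fin n)} {w : ℤ} {N : ℕ}
    {F : CurveParam → (Fin n → ℂ) → ℂ → ℂ} (hF : IsLaurent S (w + 1) N F) (α : ℤˣ) :
    ∃ c ∈ adm S w, ∀ θ, ∀ z ∈ offBranch n, ∀ f : ℂ → ℂ,
      (∀ᶠ t in 𝓝[≠] (0 : ℂ),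
        f (sgn α * Complex.exp t) * (sgn α * Complex.exp t) = F θ z t) →
      HasResidueAt f (sgn α) (c θ z) := by
  obtain ⟨h, h1, h2⟩ := hF.mono_order (Nat.le_succ N)
  refine ⟨_, adm_ratCast_mul (1 / N.factorial : ℚ) (adm_mono ?_ (h1 N)), fun θ z hz f hf => ?_⟩
  · push_cast
    omega
  · have := hasResidueAt_of_exp (f := f) (sgn_sq α) (N := N) (h2 θ z hz).1 (by
      filter_upwards [hf, (h2 θ z hz).2] with t ht ht'
      rw [ht, ht'])
    refine (congrArg (HasResidueAt f (sgn α)) ?_).mp this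
    push_cast
    ring

/-- The truncated curve with parameters `θ`. -/
noncomputable def curve (θ : CurveParam) : RationalSpectralCurve := truncatedCurve θ.q θ.M

/-- The correlation differentials as functions of the parameters and the arguments. -/
noncomputable def omegaFun (g n : ℕ) : CurveParam → (Fin n → ℂ) → ℂ :=
  fun θ z => (curve θ).omega g n z

theorem curve_y_eq (θ : CurveParam) {p t : ℂ} (hp : p ≠ 0)
    (hpt : (p - p⁻¹) ^ 2 = sqDiff t) :
    (curve θ).y p = 1 / 2 * (p - p⁻¹) * curveProd θ t := by
  have h : ∏ k ∈ Finset.Icc 1 θ.M, (1 - θ.q ^ k * p ^ 2) * (1 - θ.q ^ k * (p⁻¹) ^ 2) /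
      (1 - θ.q ^ k) ^ 2 = curveProd θ t := by
    rw [curveProd, ← Finset.prod_coe_sort]
    refine Finset.prod_congr rfl fun k _ => ?_
    have hk : 1 - θ.q ^ (k : ℕ) ≠ 0 := sub_ne_zero.2 (θ.pow_ne_one k k.2).symm
    rw [zetaRoot, ← hpt]
    field_simp
    ring
  rw [← h]
  rfl

/-- The denominator of the recursion kernel; it does not depend on the base point `a` of the
involution. -/
theorem curve_omega01_sub (θ : CurveParam) {p t : ℂ} (a : ℂ) (hp : p ≠ 0)
    (hpt : (p - p⁻¹) ^ 2 = sqDiff t) :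
    (curve θ).omega01 p - (curve θ).omega01 ((curve θ).σ a p) * deriv ((curve θ).σ a) p =
      sqDiff t * curveProd θ t * p⁻¹ := by
  have hσ : (curve θ).σ a = fun z => z⁻¹ := rfl
  have hx : (curve θ).x = fun z => z + z⁻¹ := rfl
  have h1 := curve_y_eq θ hp hpt
  have h2 := curve_y_eq θ (inv_ne_zero hp) (t := t) (by rw [inv_inv, ← hpt]; ring)
  rw [RationalSpectralCurve.omega01, RationalSpectralCurve.omega01, hσ, hx, deriv_add_inv hp]
  simp only [deriv_inv]
  rw [deriv_add_inv (inv_ne_zero hp), h1, h2, ← hpt]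
  field_simp
  ring

theorem integral_omega02_segment {z p r : ℂ} (h : z ∉ segment ℝ p r) :
    (∫ t in (0 : ℝ)..1, RationalSpectralCurve.omega02 z (p + (t : ℂ) * (r - p)) * (r - p)) =
      (z - r)⁻¹ - (z - p)⁻¹ := by
  have hne : ∀ t ∈ Set.uIcc (0 : ℝ) 1, z - (p + (t : ℂ) * (r - p)) ≠ 0 := by
    intro t ht h0
    rw [Set.uIcc_of_le zero_le_one] at ht
    refine h ?_
    rw [segment_eq_image']
    refine ⟨t, ht, ?_⟩
    simp only [Complex.real_smul]
    linear_combination -h0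
  have hd : ∀ t ∈ Set.uIcc (0 : ℝ) 1,
      HasDerivAt (fun t : ℝ => (z - (p + (t : ℂ) * (r - p)))⁻¹)
        (RationalSpectralCurve.omega02 z (p + (t : ℂ) * (r - p)) * (r - p)) t := by
    intro t ht
    have h1 : HasDerivAt (fun t : ℝ => z - (p + (t : ℂ) * (r - p))) (-(1 * (r - p))) t :=
      ((((hasDerivAt_id t).ofReal_comp).mul_const (r - p)).const_add p).const_sub z
    refine (h1.inv (hne t ht)).congr_deriv ?_
    rw [RationalSpectralCurve.omega02]
    ring
  rw [intervalIntegral.integral_eq_sub_of_hasDerivAt hd]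
  · simp
  · refine ContinuousOn.intervalIntegrable fun t ht => ?_
    simp only [RationalSpectralCurve.omega02]
    have h2 : ContinuousAt (fun t : ℝ => (z - (p + (t : ℂ) * (r - p))) ^ 2) t := by fun_prop
    exact ((continuousAt_const.div h2 (pow_ne_zero 2 (hne t ht))).mul
      continuousAt_const).continuousWithinAt

theorem sub_inv_sq_eq_sqDiff (α : ℤˣ) (t : ℂ) :
    (sgn α * Complex.exp t - (sgn α * Complex.exp t)⁻¹) ^ 2 = sqDiff t := by
  rw [inv_sgn_mul_exp, ← mul_sub, mul_pow, sgn_sq, one_mul, sqDiff]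

theorem eventually_kernel_eq (θ : CurveParam) (α : ℤˣ) {z : ℂ} (hz : z ≠ 1 ∧ z ≠ -1) :
    ∀ᶠ t in 𝓝[≠] (0 : ℂ), (curve θ).kernel (sgn α) z (sgn α * Complex.exp t) =
      1 / 2 * (kernelNum α z t * (sqDiff t * curveProd θ t)⁻¹) * (sgn α * Complex.exp t) := by
  have hzα : z ≠ sgn α := by
    rcases Int.units_eq_one_or α with rfl | rfl
    · simpa [sgn] using hz.1
    · simpa [sgn] using hz.2
  have hball : ∀ᶠ p in 𝓝 (sgn α), p ∈ Metric.ball (sgn α) (dist z (sgn α)) :=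
    Metric.ball_mem_nhds _ (dist_pos.2 hzα)
  have ht1 : Tendsto (fun t => sgn α * Complex.exp t) (𝓝[≠] 0) (𝓝 (sgn α)) := by
    have : ContinuousAt (fun t => sgn α * Complex.exp t) 0 := by fun_prop
    have := this.tendsto.mono_left (nhdsWithin_le_nhds (s := {0}ᶜ))
    simpa using this
  filter_upwards [ht1.eventually hball,
    (ht1.comp tendsto_neg_nhdsNE_zero).eventually hball] with t h1 h2
  have h0 : sgn α * Complex.exp t ≠ 0 := mul_ne_zero (sgn_ne_zero α) (Complex.exp_ne_zero t)
  have hσ : (curve θ).σ (sgn α) (sgn α * Complex.exp t) = sgn α * Complex.exp (-t) :=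
    inv_sgn_mul_exp α t
  rw [RationalSpectralCurve.kernel, curve_omega01_sub θ _ h0 (sub_inv_sq_eq_sqDiff α t), hσ,
    integral_omega02_segment, kernelNum]
  · rw [div_eq_mul_inv, mul_inv _ (sgn α * Complex.exp t)⁻¹, inv_inv]
    ring
  · intro hmem
    have := (convex_ball (sgn α) (dist z (sgn α))).segment_subset h1 h2 hmem
    simp at this

section Terms

variable {m : ℕ}

/-- The summand `T` of the bracket in the recursion, multiplied by the kernel, has a residue at `α`
that is admissible of degree at most `w` as a function of all the variables `z`. -/
def HasAdmResidue (α : ℤˣ) (w : ℤ) (T : CurveParam → (Fin (m + 1) → ℂ) → ℂ → ℂ) : Prop :=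
  ∃ c ∈ adm (Finset.univ : Finset (Fin (m + 1))) w, ∀ θ, ∀ z ∈ offBranch (m + 1),
    HasResidueAt (fun p => (curve θ).kernel (sgn α) (z 0) p * T θ z p) (sgn α) (c θ z)

theorem HasAdmResidue.add {α : ℤˣ} {w : ℤ} {T U : CurveParam → (Fin (m + 1) → ℂ) → ℂ → ℂ}
    (hT : HasAdmResidue α w T) (hU : HasAdmResidue α w U) :
    HasAdmResidue α w fun θ z p => T θ z p + U θ z p := by
  obtain ⟨c, hc, h⟩ := hT
  obtain ⟨d, hd, h'⟩ := hU
  refine ⟨c + d, Submodule.add_mem _ hc hd, fun θ z hz => ?_⟩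
  simp only [mul_add]
  exact (h θ z hz).add (h' θ z hz)

theorem HasAdmResidue.zero (α : ℤˣ) (w : ℤ) :
    HasAdmResidue α w fun (_ : CurveParam) (_ : Fin (m + 1) → ℂ) _ => 0 := by
  refine ⟨0, Submodule.zero_mem _, fun θ z hz => ?_⟩
  simpa using hasResidueAt_of_analyticAt (α := sgn α) (f := fun _ => 0) analyticAt_const

theorem HasAdmResidue.sum {ι : Type*} (s : Finset ι) {α : ℤˣ} {w : ℤ}
    {T : ι → CurveParam → (Fin (m + 1) → ℂ) → ℂ → ℂ} (h : ∀ i ∈ s, HasAdmResidue α w (T i)) :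
    HasAdmResidue α w fun θ z p => ∑ i ∈ s, T i θ z p := by
  classical
  induction s using Finset.induction_on with
  | empty => simpa using HasAdmResidue.zero α w
  | insert a s ha ih =>
    simp only [Finset.sum_insert ha]
    exact (h a (Finset.mem_insert_self a s)).add
      (ih fun i hi => h i (Finset.mem_insert_of_mem hi))

/-- The variables other than the first. -/
def tailVars (m : ℕ) : Finset (Fin (m + 1)) := Finset.univ.map (Fin.succEmb m)

theorem zero_union_tailVars (m : ℕ) : {0} ∪ tailVars m = Finset.univ := by
  ext i
  refine Fin.cases ?_ (fun j => ?_) i <;> simp [tailVars]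

theorem disjoint_zero_tailVars (m : ℕ) : Disjoint {0} (tailVars m) := by
  simp [tailVars]

theorem isLaurent_kernel (α : ℤˣ) :
    IsLaurent {(0 : Fin (m + 1))} 1 2 fun θ z t =>
      1 / 2 * (kernelNum α (z 0) t * (sqDiff t * curveProd θ t)⁻¹) := by
  have h := ((isLaurent_inv_sqDiff_mul_curveProd (n := m + 1)).mul_left
    (isLaurent_kernelNum α 0)).ratCast_mul (1 / 2)
  refine h.congr fun θ z hz => Eventually.of_forall fun t => ?_
  push_cast
  ring

theorem sqDiff_neg (t : ℂ) : sqDiff (-t) = sqDiff t := by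
  rw [sqDiff, sqDiff, neg_neg]
  ring

theorem kernel_factor_neg (θ : CurveParam) (α : ℤˣ) (z t : ℂ) :
    1 / 2 * (kernelNum α z (-t) * (sqDiff (-t) * curveProd θ (-t))⁻¹) =
      -(1 / 2 * (kernelNum α z t * (sqDiff t * curveProd θ t)⁻¹)) := by
  simp only [curveProd, sqDiff_neg, kernelNum, neg_neg]
  ring

/-- A summand `T(p)` such that `p ^ 2 T(p)` has an expansion with admissible coefficients up to
an odd function of `t`, which the odd kernel makes invisible to the residue. -/
theorem hasAdmResidue_of_isLaurent_add_odd {α : ℤˣ} {w : ℤ} {N : ℕ}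
    {T L R : CurveParam → (Fin (m + 1) → ℂ) → ℂ → ℂ} (hL : IsLaurent (tailVars m) w N L)
    (hR : ∀ θ, ∀ z ∈ offBranch (m + 1), MeromorphicAt (R θ z) 0)
    (hodd : ∀ θ, ∀ z ∈ offBranch (m + 1), ∀ᶠ t in 𝓝[≠] 0, R θ z (-t) = -R θ z t)
    (hT : ∀ θ, ∀ z ∈ offBranch (m + 1), ∀ᶠ t in 𝓝[≠] 0,
      (sgn α * Complex.exp t) ^ 2 * T θ z (sgn α * Complex.exp t) = L θ z t + R θ z t) :
    HasAdmResidue α w T := by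
  have h1 := IsLaurent.mul (disjoint_zero_tailVars m) (isLaurent_kernel α) hL
  rw [zero_union_tailVars, add_comm 1 w] at h1
  obtain ⟨c, hc, hres⟩ := h1.exists_residue α
  refine ⟨c, hc, fun θ z hz => ?_⟩
  -- The part of the integrand that comes from `R`, as a function of `p = α e ^ t`.
  set Q : ℂ → ℂ := fun p => (curve θ).kernel (sgn α) (z 0) p *
    (R θ z (Complex.log (sgn α * p)) / p ^ 2) with hQ
  have hlog : ∀ᶠ t in 𝓝[≠] (0 : ℂ),
      Complex.log (sgn α * (sgn α * Complex.exp t)) = t := by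
    have h : ∀ᶠ t in 𝓝 (0 : ℂ), Complex.log (Complex.exp t) = t := by
      have : ∀ᶠ t in 𝓝 (0 : ℂ), ‖t‖ < Real.pi :=
        continuous_norm.continuousAt.eventually_lt_const (by simpa using Real.pi_pos)
      filter_upwards [this] with t ht
      have h2 := (Complex.abs_im_le_norm t).trans_lt ht
      rw [abs_lt] at h2
      exact Complex.log_exp h2.1 h2.2.le
    filter_upwards [h.filter_mono nhdsWithin_le_nhds] with t ht
    rw [← mul_assoc, sgn_mul_self, one_mul, ht]
  have hker := eventually_kernel_eq θ α (hz 0)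
  have hQ0 : HasResidueAt Q (sgn α) 0 := by
    refine hasResidueAt_zero_of_even α
      (((isLaurent_kernel (m := m) α).meromorphicAt θ hz).fun_mul (hR θ z hz)) ?_ ?_
    · filter_upwards [hodd θ z hz] with t ht
      rw [ht, kernel_factor_neg]
      ring
    · filter_upwards [hlog, hker] with t h2 h3
      have h0 : sgn α * Complex.exp t ≠ 0 :=
        mul_ne_zero (sgn_ne_zero α) (Complex.exp_ne_zero t)
      simp only [hQ, h2, h3]
      generalize sgn α * Complex.exp t = p at h0
      field_simp
  have hmain := hres θ z hz
    (fun p => (curve θ).kernel (sgn α) (z 0) p * T θ z p - Q p) (by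
    filter_upwards [hlog, hker, hT θ z hz] with t h2 h3 h4
    have h0 : sgn α * Complex.exp t ≠ 0 :=
      mul_ne_zero (sgn_ne_zero α) (Complex.exp_ne_zero t)
    simp only [hQ, h2, h3]
    have h5 : T θ z (sgn α * Complex.exp t) =
        (L θ z t + R θ z t) / (sgn α * Complex.exp t) ^ 2 := by
      rw [← h4, mul_div_cancel_left₀ _ (pow_ne_zero 2 h0)]
    rw [h5]
    generalize sgn α * Complex.exp t = p at h0
    field_simp
    ring)
  have := hmain.add hQ0
  simpa using this

theorem hasAdmResidue_of_isLaurent {α : ℤˣ} {w : ℤ} {N : ℕ}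
    {T L : CurveParam → (Fin (m + 1) → ℂ) → ℂ → ℂ} (hL : IsLaurent (tailVars m) w N L)
    (hT : ∀ θ, ∀ z ∈ offBranch (m + 1), ∀ᶠ t in 𝓝[≠] 0,
      (sgn α * Complex.exp t) ^ 2 * T θ z (sgn α * Complex.exp t) = L θ z t) :
    HasAdmResidue α w T := by
  refine hasAdmResidue_of_isLaurent_add_odd hL (R := fun _ _ _ => 0) (fun _ _ _ => by fun_prop)
    (by simp) ?_
  simpa using hT

theorem bidiff_zero (α : ℤˣ) {z : ℂ} (hz : z ≠ 1 ∧ z ≠ -1) : bidiff α z 0 = xi α 0 z := by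
  have := iteratedDeriv_bidiff_neg (α := α) hz 0
  simpa [xi] using this

/-- The summand `B(p, zᵢ) B(p⁻¹, zⱼ)`: the kernel has a simple pole, so that only the values at
the branch point matter. -/
theorem hasAdmResidue_bidiff_mul_bidiff {α : ℤˣ} {i j : Fin (m + 1)}
    (hij : Disjoint ({i} : Finset (Fin (m + 1))) {j})
    (htail : {i} ∪ {j} = tailVars m) {T : CurveParam → (Fin (m + 1) → ℂ) → ℂ → ℂ}
    (hT : ∀ θ, ∀ z ∈ offBranch (m + 1), ∀ᶠ t in 𝓝[≠] 0,
      (sgn α * Complex.exp t) ^ 2 * T θ z (sgn α * Complex.exp t) =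
        -(bidiff α (z i) t * bidiff α (z j) (-t))) :
    HasAdmResidue α 0 T := by
  obtain ⟨h, h1, h2⟩ := isLaurent_kernel (m := m) α
  have hc := adm_mul (disjoint_zero_tailVars m) (h1 1)
    (htail ▸ adm_mul hij (adm_xi i α 0) (adm_xi j α 0))
  rw [zero_union_tailVars] at hc
  refine ⟨_, adm_mono (by simp) (adm_ratCast_mul (-1) hc), fun θ z hz => ?_⟩
  obtain ⟨h3, h4⟩ := h2 θ z hz
  have hBi := analyticAt_bidiff (α := α) (hz i)
  have hBj : AnalyticAt ℂ (fun t => bidiff α (z j) (-t)) 0 :=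
    AnalyticAt.fun_comp (g := bidiff α (z j)) (by simpa using analyticAt_bidiff (hz j))
      (by fun_prop)
  have hBB := hBi.fun_mul hBj
  -- The constant term of `h` has degree at most `-1`, so the pole is in fact simple.
  have h0 : h θ z 0 = 0 := eq_zero_of_adm_neg (by norm_num) (h1 0) θ hz
  have key := hasResidueAt_of_exp
    (f := fun p => (curve θ).kernel (sgn α) (z 0) p * T θ z p) (sgn_sq α) (N := 1)
    (h := fun t => -(h θ z t * (bidiff α (z i) t * bidiff α (z j) (-t))))
    (h3.fun_mul hBB).fun_neg (by
      filter_upwards [h4, hT θ z hz, eventually_kernel_eq θ α (hz 0)] with t h5 h6 h7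
      rw [h7, h5]
      linear_combination (h θ z t / t ^ 2) * h6)
  refine (congrArg (HasResidueAt _ (sgn α)) ?_).mp key
  rw [iteratedDeriv_one, (h3.differentiableAt.hasDerivAt.fun_mul
    hBB.differentiableAt.hasDerivAt).fun_neg.deriv, h0]
  simp only [neg_zero, bidiff_zero α (hz i), bidiff_zero α (hz j), iteratedDeriv_one]
  push_cast
  simp

/-- `F` is a possible factor of a summand of the recursion, coming from one correlation differential
`ω_{g, k + 1}`: either it is even in `t` with an admissible expansion, or it is the bidifferential
`B(p, z i)`, which counts as having degree `0`. -/
def IsFactor {n : ℕ} (α : ℤˣ) (S : Finset (Fin n)) (w : ℤ)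
    (F : CurveParam → (Fin n → ℂ) → ℂ → ℂ) : Prop :=
  ((∃ N, IsLaurent S w N F) ∧
      ∀ θ, ∀ z ∈ offBranch n, ∀ᶠ t in 𝓝[≠] 0, F θ z (-t) = F θ z t) ∨
    (w = 0 ∧ ∃ i, S = {i} ∧ ∀ θ z t, F θ z t = bidiff α (z i) t)

theorem isFactor_slotOne {n k g : ℕ} (α : ℤˣ) (e : Fin k ↪ Fin n) (h01 : ¬(g = 0 ∧ k = 0))
    (ih : ¬(g = 0 ∧ k = 1) → omegaFun g (k + 1) ∈ adm Finset.univ (6 * g - 6 + 2 * (k + 1))) :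
    IsFactor α (Finset.univ.map e) (6 * g + 2 * k - 2) (slotOne α e (omegaFun g (k + 1))) := by
  by_cases h02 : g = 0 ∧ k = 1
  · obtain ⟨rfl, rfl⟩ := h02
    refine Or.inr ⟨by norm_num, e 0, by simp, fun θ z t => ?_⟩
    change _ * (curve θ).omega 0 2 _ = _
    rw [RationalSpectralCurve.omega, RationalSpectralCurve.omega02, bidiff, mul_one_div]
    rfl
  · obtain ⟨⟨N, hN⟩, heven⟩ := isLaurent_slotOne α e (ih h02)
    exact Or.inl ⟨⟨N, hN.mono (by omega)⟩, heven⟩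

theorem meromorphicAt_bidiff_sub {α : ℤˣ} {z : ℂ} (hz : z ≠ 1 ∧ z ≠ -1) :
    MeromorphicAt (fun t => bidiff α z t - bidiff α z (-t)) 0 := by
  have hneg : AnalyticAt ℂ (fun t => bidiff α z (-t)) 0 :=
    AnalyticAt.fun_comp (g := bidiff α z) (by simpa using analyticAt_bidiff hz) (by fun_prop)
  exact ((analyticAt_bidiff hz).fun_sub hneg).meromorphicAt

/-- The residue of a summand with two factors, each of them stable or the bidifferential `B`. -/
theorem IsFactor.hasAdmResidue {α : ℤˣ} {S₁ S₂ : Finset (Fin (m + 1))} {w₁ w₂ : ℤ}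
    {F G T : CurveParam → (Fin (m + 1) → ℂ) → ℂ → ℂ}
    (hdisj : Disjoint S₁ S₂) (htail : S₁ ∪ S₂ = tailVars m)
    (hF : IsFactor α S₁ w₁ F) (hG : IsFactor α S₂ w₂ G)
    (hT : ∀ θ, ∀ z ∈ offBranch (m + 1), ∀ᶠ t in 𝓝[≠] 0,
      (sgn α * Complex.exp t) ^ 2 * T θ z (sgn α * Complex.exp t) = -(F θ z t * G θ z (-t))) :
    HasAdmResidue α (w₁ + w₂) T := by
  rcases hF with ⟨⟨N, hN⟩, hFe⟩ | ⟨rfl, i, rfl, hFi⟩ <;>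
    rcases hG with ⟨⟨K, hK⟩, hGe⟩ | ⟨rfl, j, rfl, hGj⟩
  · refine hasAdmResidue_of_isLaurent (htail ▸ (IsLaurent.mul hdisj hN hK).ratCast_mul (-1))
      fun θ z hz => ?_
    filter_upwards [hT θ z hz, hGe θ z hz] with t h1 h2
    rw [h1, h2]
    push_cast
    ring
  · refine hasAdmResidue_of_isLaurent_add_odd
      (R := fun θ z t => F θ z t * (bidiff α (z j) t - bidiff α (z j) (-t)) * (1 / 2))
      (htail ▸ (IsLaurent.mul hdisj hN (isLaurent_bidiffEven α j)).ratCast_mul (-1))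
      (fun θ z hz => ((hN.meromorphicAt θ hz).fun_mul (meromorphicAt_bidiff_sub (hz j))).fun_mul
        (MeromorphicAt.const _ _)) (fun θ z hz => ?_) fun θ z hz => ?_
    · filter_upwards [hFe θ z hz] with t h1
      rw [h1, neg_neg]
      ring
    · filter_upwards [hT θ z hz] with t h1
      rw [h1, hGj, bidiffEven]
      push_cast
      ring
  · refine hasAdmResidue_of_isLaurent_add_odd
      (R := fun θ z t => G θ z t * (bidiff α (z i) t - bidiff α (z i) (-t)) * (-1 / 2))
      (htail ▸ (IsLaurent.mul hdisj (isLaurent_bidiffEven α i) hK).ratCast_mul (-1))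
      (fun θ z hz => ((hK.meromorphicAt θ hz).fun_mul (meromorphicAt_bidiff_sub (hz i))).fun_mul
        (MeromorphicAt.const _ _)) (fun θ z hz => ?_) fun θ z hz => ?_
    · filter_upwards [hGe θ z hz] with t h1
      rw [h1, neg_neg]
      ring
    · filter_upwards [hT θ z hz, hGe θ z hz] with t h1 h2
      rw [h1, hFi, h2, bidiffEven]
      push_cast
      ring
  · refine hasAdmResidue_bidiff_mul_bidiff hdisj htail fun θ z hz => ?_
    filter_upwards [hT θ z hz] with t h1
    rw [h1, hFi, hGj]

end Terms

theorem isLaurent_inv_sqDiff {n : ℕ} :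
    IsLaurent (∅ : Finset (Fin n)) 2 2 fun _ _ t => (sqDiff t)⁻¹ := by
  refine ((isLaurent_inv_sqDiff_mul_curveProd (n := n)).mul_left isLaurent_curveProd).congr
    fun θ z hz => ?_
  have : ∀ᶠ t in 𝓝 (0 : ℂ), curveProd θ t ≠ 0 :=
    (analyticAt_curveProd θ).continuousAt.eventually_ne (by rw [curveProd_zero]; exact one_ne_zero)
  filter_upwards [this.filter_mono nhdsWithin_le_nhds] with t ht
  rw [mul_inv, inv_mul_cancel_right₀ ht]

/-- The inclusion of the variables indexed by `I` among the last `m` variables. -/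
def tailEmb {m : ℕ} (I : Finset (Fin m)) : Fin I.card ↪ Fin (m + 1) :=
  (I.orderEmbOfFin rfl).toEmbedding.trans (Fin.succEmb m)

theorem map_tailEmb {m : ℕ} (I : Finset (Fin m)) :
    Finset.univ.map (tailEmb I) = I.map (Fin.succEmb m) := by
  rw [tailEmb, ← Finset.map_map]
  congr 1
  ext i
  simp

/-- The summand `ω_{g - 1, m + 2}(p, p⁻¹, z)`, which for `ω_{1, 1}` is `B(p, p⁻¹)`. -/
theorem hasAdmResidue_slotTwo {g m : ℕ} (α : ℤˣ) (hg : 0 < g)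
    (ih : ¬(g = 1 ∧ m = 0) →
      omegaFun (g - 1) (m + 2) ∈ adm Finset.univ (6 * ((g : ℤ) - 1) - 6 + 2 * (m + 2))) :
    HasAdmResidue (m := m) α (6 * g - 6 + 2 * (m + 1)) fun θ z p =>
      (curve θ).omega (g - 1) (m + 2) (Fin.cons p (Fin.cons p⁻¹ (Fin.tail z))) *
        deriv (fun z : ℂ => z⁻¹) p := by
  by_cases h : g = 1 ∧ m = 0
  · obtain ⟨rfl, rfl⟩ := h
    refine hasAdmResidue_of_isLaurent (L := fun θ z t => (-1 : ℚ) * (sqDiff t)⁻¹) (N := 2)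
      ((isLaurent_inv_sqDiff.ratCast_mul (-1)).mono (by norm_num)) fun θ z hz =>
      Eventually.of_forall fun t => ?_
    have h0 : sgn α * Complex.exp t ≠ 0 := mul_ne_zero (sgn_ne_zero α) (Complex.exp_ne_zero t)
    change _ * ((curve θ).omega 0 2 _ * _) = _
    rw [RationalSpectralCurve.omega, RationalSpectralCurve.omega02, deriv_inv,
      ← sub_inv_sq_eq_sqDiff α]
    simp only [Fin.cons_zero, Fin.cons_one]
    generalize sgn α * Complex.exp t = p at h0
    push_cast
    field_simp
  · obtain ⟨N, hN⟩ := isLaurent_slotTwo α (Fin.succEmb m) (ih h)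
    refine hasAdmResidue_of_isLaurent ((hN.ratCast_mul (-1)).mono (by omega)) fun θ z hz =>
      Eventually.of_forall fun t => ?_
    have h0 : sgn α * Complex.exp t ≠ 0 := mul_ne_zero (sgn_ne_zero α) (Complex.exp_ne_zero t)
    rw [slotTwo, deriv_inv, omegaFun]
    have : z ∘ Fin.succEmb m = Fin.tail z := rfl
    rw [this]
    push_cast
    generalize sgn α * Complex.exp t = p at h0
    field_simp

/-- The summand `ω_{g₁}(p, z_I) ω_{g₂}(p⁻¹, z_J)`, where `J` is the complement of `I`. -/
theorem hasAdmResidue_slotOne_mul {g₁ g₂ m : ℕ} (α : ℤˣ) (I : Finset (Fin m))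
    (h₁ : ¬(g₁ = 0 ∧ I.card = 0)) (h₂ : ¬(g₂ = 0 ∧ Iᶜ.card = 0))
    (ih₁ : ¬(g₁ = 0 ∧ I.card = 1) →
      omegaFun g₁ (I.card + 1) ∈ adm Finset.univ (6 * g₁ - 6 + 2 * (I.card + 1)))
    (ih₂ : ¬(g₂ = 0 ∧ Iᶜ.card = 1) →
      omegaFun g₂ (Iᶜ.card + 1) ∈ adm Finset.univ (6 * g₂ - 6 + 2 * (Iᶜ.card + 1))) :
    HasAdmResidue (m := m) α (6 * (g₁ + g₂) - 6 + 2 * (m + 1)) fun θ z p =>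
      (curve θ).omega g₁ (I.card + 1)
          (Fin.cons p (RationalSpectralCurve.subtuple (Fin.tail z) I)) *
        ((curve θ).omega g₂ (Iᶜ.card + 1)
          (Fin.cons p⁻¹ (RationalSpectralCurve.subtuple (Fin.tail z) Iᶜ)) *
          deriv (fun z : ℂ => z⁻¹) p) := by
  have hcard : (I.card : ℤ) + Iᶜ.card = m := by
    have := Finset.card_add_card_compl I
    rw [Fintype.card_fin] at this
    exact_mod_cast this
  have hw : 6 * ((g₁ : ℤ) + g₂) - 6 + 2 * (m + 1) =
      (6 * g₁ + 2 * I.card - 2) + (6 * g₂ + 2 * Iᶜ.card - 2) := by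
    rw [← hcard]; ring
  rw [hw]
  refine IsFactor.hasAdmResidue ?_ ?_ (isFactor_slotOne α (tailEmb I) h₁ ih₁)
    (isFactor_slotOne α (tailEmb Iᶜ) h₂ ih₂) fun θ z hz => Eventually.of_forall fun t => ?_
  · rw [map_tailEmb, map_tailEmb, Finset.disjoint_map]
    exact disjoint_compl_right
  · rw [map_tailEmb, map_tailEmb, ← Finset.map_union, Finset.union_compl, tailVars]
  · have h0 : sgn α * Complex.exp t ≠ 0 := mul_ne_zero (sgn_ne_zero α) (Complex.exp_ne_zero t)
    rw [slotOne, slotOne, ← inv_sgn_mul_exp, omegaFun, omegaFun, deriv_inv]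
    have e1 : z ∘ tailEmb I = RationalSpectralCurve.subtuple (Fin.tail z) I := rfl
    have e2 : z ∘ tailEmb Iᶜ = RationalSpectralCurve.subtuple (Fin.tail z) Iᶜ := rfl
    rw [e1, e2]
    generalize sgn α * Complex.exp t = p at h0
    field_simp

/-- The correlation differentials are combinations of products of elementary differentials, with
coefficients that are polynomials in the `q`-zeta values. -/
theorem omegaFun_mem_adm (g n : ℕ) (hn : 0 < n) (h01 : ¬(g = 0 ∧ n = 1)) (h02 : ¬(g = 0 ∧ n = 2)) :
    omegaFun g n ∈ adm Finset.univ (6 * g - 6 + 2 * n) := by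
  induction hN : 2 * g + n using Nat.strong_induction_on generalizing g n with
  | _ N ih =>
    obtain ⟨m, rfl⟩ : ∃ m, n = m + 1 := ⟨n - 1, by omega⟩
    have hres : ∀ α : ℤˣ, HasAdmResidue (m := m) α (6 * g - 6 + 2 * (m + 1)) fun θ z p =>
        (if _ : 0 < g then
          (curve θ).omega (g - 1) (m + 2) (Fin.cons p (Fin.cons p⁻¹ (Fin.tail z))) *
            deriv (fun z : ℂ => z⁻¹) p
        else 0) +
        ∑ g₁ : Fin (g + 1), ∑ I : Finset (Fin m),
          if _ : ¬ ((g₁ : ℕ) = 0 ∧ I.card = 0) ∧ ¬ (g - (g₁ : ℕ) = 0 ∧ Iᶜ.card = 0) then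
            (curve θ).omega g₁ (I.card + 1)
              (Fin.cons p (RationalSpectralCurve.subtuple (Fin.tail z) I)) *
              ((curve θ).omega (g - g₁) (Iᶜ.card + 1)
                (Fin.cons p⁻¹ (RationalSpectralCurve.subtuple (Fin.tail z) Iᶜ)) *
                deriv (fun z : ℂ => z⁻¹) p)
          else 0 := by
      intro α
      refine HasAdmResidue.add ?_ (HasAdmResidue.sum _ fun g₁ _ => HasAdmResidue.sum _ fun I _ => ?_)
      · by_cases hg : 0 < g
        · simp only [hg, dite_true]
          refine hasAdmResidue_slotTwo α hg fun h => ?_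
          have := ih (2 * (g - 1) + (m + 2)) (by omega) (g - 1) (m + 2) (by omega) (by omega)
            (by omega) rfl
          push_cast [Nat.one_le_iff_ne_zero.2 hg.ne'] at this
          exact this
        · simp only [hg, dite_false]
          exact HasAdmResidue.zero α _
      · have h1 := Finset.card_add_card_compl I
        have h2 := g₁.isLt
        rw [Fintype.card_fin] at h1
        by_cases h : ¬ ((g₁ : ℕ) = 0 ∧ I.card = 0) ∧ ¬ (g - (g₁ : ℕ) = 0 ∧ Iᶜ.card = 0)
        · simp only [h, dite_true, not_false_eq_true, and_self]
          have hg : (g : ℤ) = ((g₁ : ℕ) : ℤ) + ((g - (g₁ : ℕ) : ℕ) : ℤ) := by omega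
          rw [hg]
          refine hasAdmResidue_slotOne_mul α I h.1 h.2 (fun h' => ?_) (fun h' => ?_)
          · exact_mod_cast ih (2 * (g₁ : ℕ) + (I.card + 1)) (by omega) g₁ (I.card + 1) (by omega)
              (by omega) (by omega) rfl
          · exact_mod_cast ih (2 * (g - (g₁ : ℕ)) + (Iᶜ.card + 1)) (by omega) (g - g₁)
              (Iᶜ.card + 1) (by omega) (by omega) (by omega) rfl
        · simp only [h, dite_false]
          exact HasAdmResidue.zero α _
    obtain ⟨c, hc, hcr⟩ := hres 1
    obtain ⟨d, hd, hdr⟩ := hres (-1)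
    push_cast
    refine adm_congr (Submodule.add_mem _ hc hd) fun θ z hz => ?_
    have e1 := (hcr θ z hz).contourResidue_eq
    have e2 := (hdr θ z hz).contourResidue_eq
    have s1 : sgn 1 = 1 := by simp [sgn]
    have s2 : sgn (-1) = -1 := by simp [sgn]
    rw [s1] at e1
    rw [s2] at e2
    have hb : (curve θ).branch = {1, -1} := rfl
    rw [Pi.add_apply, Pi.add_apply, ← e1, ← e2, omegaFun, RationalSpectralCurve.omega, hb,
      Finset.sum_pair (by norm_num)]
    · rfl
    all_goals omega

/-! ### Expansions at the origin -/

theorem summable_pow_mul_pow_pred (k : ℕ) {r : ℝ} (hr0 : 0 ≤ r) (hr : r < 1) :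
    Summable fun b : ℕ+ => (b : ℝ) ^ k * r ^ ((b : ℕ) - 1) := by
  have hs : 0 < (1 + r) / 2 := by linarith
  have hs1 : (1 + r) / 2 < 1 := by linarith
  have h := ((summable_pow_mul_geometric_of_norm_lt_one k
    (r := (1 + r) / 2) (by rwa [Real.norm_of_nonneg hs.le])).comp_injective
      PNat.coe_injective).mul_right ((1 + r) / 2)⁻¹
  refine Summable.of_nonneg_of_le (fun b => by positivity) (fun b => ?_) h
  have hb : ((1 + r) / 2) ^ (b : ℕ) = ((1 + r) / 2) ^ ((b : ℕ) - 1) * ((1 + r) / 2) := by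
    rw [← pow_succ, Nat.sub_add_cancel b.pos]
  simp only [Function.comp_apply]
  rw [hb, ← mul_assoc, mul_inv_cancel_right₀ hs.ne']
  gcongr
  linarith

/-- The derivatives of `chi β z` may be computed termwise in the expansion
`chi β z t = ∑ b, β ^ b e ^ (b t) z ^ (b - 1)`. -/
theorem hasSum_iteratedDeriv_chi (β : ℤˣ) {z : ℂ} (hz : ‖z‖ < Real.exp (-1)) (k : ℕ) {t : ℂ}
    (ht : t.re < 1) :
    HasSum (fun b : ℕ+ => ((b : ℕ) : ℂ) ^ k * (sgn β * Complex.exp t) ^ (b : ℕ) *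
      z ^ ((b : ℕ) - 1)) (iteratedDeriv k (chi β z) t) := by
  have hr : Real.exp 1 * ‖z‖ < 1 := by
    calc Real.exp 1 * ‖z‖ < Real.exp 1 * Real.exp (-1) := by gcongr
      _ = 1 := by rw [← Real.exp_add, add_neg_cancel, Real.exp_zero]
  have hr0 : 0 ≤ Real.exp 1 * ‖z‖ := by positivity
  have hU : IsOpen {t : ℂ | t.re < 1} := isOpen_lt Complex.continuous_re continuous_const
  have hexp : ∀ t : ℂ, t.re < 1 → ‖sgn β * Complex.exp t‖ ≤ Real.exp 1 := by
    intro t ht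
    have h1 : ‖sgn β‖ = 1 := by
      rcases Int.units_eq_one_or β with rfl | rfl <;> simp [sgn]
    rw [norm_mul, h1, one_mul, Complex.norm_exp]
    exact Real.exp_le_exp.2 ht.le
  induction k generalizing t with
  | zero =>
    have hu := hexp t ht
    rw [iteratedDeriv_zero, chi]
    generalize sgn β * Complex.exp t = u at hu
    have huz : ‖u * z‖ < 1 := by
      rw [norm_mul]
      exact lt_of_le_of_lt (by gcongr) hr
    have h1 := (hasSum_geometric_of_norm_lt_one huz).mul_left u
    rw [← div_eq_mul_inv, ← Equiv.pnatEquivNat.hasSum_iff] at h1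
    refine (congrArg (HasSum · _) (funext fun b => ?_)).mp h1
    have hb : u ^ (b : ℕ) = u * u ^ ((b : ℕ) - 1) := by
      rw [← pow_succ', Nat.sub_add_cancel b.pos]
    rw [pow_zero, one_mul, hb, mul_assoc, ← mul_pow]
    rfl
  | succ k ih =>
    have hd : ∀ (b : ℕ+) (t : ℂ), HasDerivAt (fun t => ((b : ℕ) : ℂ) ^ k *
        (sgn β * Complex.exp t) ^ (b : ℕ) * z ^ ((b : ℕ) - 1))
        (((b : ℕ) : ℂ) ^ (k + 1) * (sgn β * Complex.exp t) ^ (b : ℕ) * z ^ ((b : ℕ) - 1)) t := by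
      intro b t
      refine (((((Complex.hasDerivAt_exp t).const_mul (sgn β)).fun_pow b).const_mul
        (((b : ℕ) : ℂ) ^ k)).mul_const (z ^ ((b : ℕ) - 1))).congr_deriv ?_
      have hb : (sgn β * Complex.exp t) ^ (b : ℕ) =
          (sgn β * Complex.exp t) ^ ((b : ℕ) - 1) * (sgn β * Complex.exp t) := by
        rw [← pow_succ, Nat.sub_add_cancel b.pos]
      rw [hb]
      ring
    have h1 := Complex.hasSum_deriv_of_summable_norm
      ((summable_pow_mul_pow_pred k hr0 hr).mul_left (Real.exp 1))
      (fun b t _ => (hd b t).differentiableAt.differentiableWithinAt) hU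
      (fun b w hw => by
        have hb : Real.exp 1 ^ (b : ℕ) = Real.exp 1 * Real.exp 1 ^ ((b : ℕ) - 1) := by
          rw [← pow_succ', Nat.sub_add_cancel b.pos]
        calc _ = (b : ℝ) ^ k * ‖sgn β * Complex.exp w‖ ^ (b : ℕ) * ‖z‖ ^ ((b : ℕ) - 1) := by
              rw [norm_mul, norm_mul, norm_pow, norm_pow, norm_pow, Complex.norm_natCast]
          _ ≤ (b : ℝ) ^ k * Real.exp 1 ^ (b : ℕ) * ‖z‖ ^ ((b : ℕ) - 1) := by
              gcongr
              exact hexp w hw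
          _ = _ := by
              rw [hb, mul_pow]
              ring) (z := t) ht
    simp only [fun b => (hd b t).deriv] at h1
    refine (congrArg (HasSum _) ?_).mp h1
    rw [iteratedDeriv_succ]
    refine EventuallyEq.deriv_eq ?_
    filter_upwards [hU.mem_nhds ht] with s hs
    exact (ih hs).tsum_eq

theorem hasSum_xi (β : ℤˣ) (d : ℕ) {z : ℂ} (hz : ‖z‖ < Real.exp (-1)) :
    HasSum (fun b : ℕ+ => ((b : ℕ) : ℂ) ^ (2 * d + 1) * sgn β ^ (b : ℕ) * z ^ ((b : ℕ) - 1))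
      (xi β d z) := by
  have h := hasSum_iteratedDeriv_chi β hz (2 * d + 1) (t := 0) (by simp)
  simp only [Complex.exp_zero, mul_one] at h
  exact h

theorem hasSum_mul_complex {ι κ : Type*} {f : ι → ℂ} {g : κ → ℂ} {a b : ℂ} (hf : HasSum f a)
    (hg : HasSum g b) : HasSum (fun x : ι × κ => f x.1 * g x.2) (a * b) :=
  hf.mul hg (summable_mul_of_summable_norm hf.summable.norm hg.summable.norm)

theorem hasSum_prod_fin {ι : Type*} (n : ℕ) {F : Fin n → ι → ℂ} {a : Fin n → ℂ}
    (h : ∀ i, HasSum (F i) (a i)) :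
    HasSum (fun b : Fin n → ι => ∏ i, F i (b i)) (∏ i, a i) := by
  induction n with
  | zero => simp
  | succ n ih =>
    have h1 := hasSum_mul_complex (h 0) (ih fun i => h i.succ)
    rw [← (Fin.consEquiv fun _ => ι).hasSum_iff, Fin.prod_univ_succ]
    refine (congrArg (HasSum · _) (funext fun x => ?_)).mp h1
    have hx : (Fin.consEquiv fun _ => ι) x = Fin.cons x.1 x.2 := rfl
    simp only [Function.comp_apply, hx, Fin.prod_univ_succ, Fin.cons_zero, Fin.cons_succ]

theorem iteratedDeriv_div_factorial_of_hasSum {f : ℂ → ℂ} {a : ℕ → ℂ} {ρ : ℝ} (hρ : 0 < ρ)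
    (h : ∀ w : ℂ, ‖w‖ < ρ → HasSum (fun j => a j * w ^ j) (f w)) (j : ℕ) :
    iteratedDeriv j f 0 / j.factorial = a j := by
  have h1 : HasFPowerSeriesAt f (FormalMultilinearSeries.ofScalars ℂ a) 0 := by
    rw [hasFPowerSeriesAt_iff']
    filter_upwards [Metric.ball_mem_nhds (0 : ℂ) hρ] with w hw
    have := h w (by simpa using hw)
    simpa [FormalMultilinearSeries.coeff_ofScalars, mul_comm] using this
  have h2 := h1.analyticAt.hasFPowerSeriesAt
  have h3 := congrArg (fun p => FormalMultilinearSeries.coeff p j)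
    (h2.eq_formalMultilinearSeries h1)
  simpa [FormalMultilinearSeries.coeff_ofScalars] using h3

/-- The iterated Taylor coefficients of the sum of a power series on a polydisc. -/
theorem taylorCoeff_of_hasSum {ρ : ℝ} (hρ : 0 < ρ) (n : ℕ) {f : (Fin n → ℂ) → ℂ}
    {c : (Fin n → ℕ) → ℂ}
    (h : ∀ z : Fin n → ℂ, (∀ i, ‖z i‖ < ρ) → HasSum (fun k => c k * ∏ i, z i ^ k i) (f z))
    (k : Fin n → ℕ) : taylorCoeff n f k = c k := by
  induction n with
  | zero =>
    have h1 := h Fin.elim0 (fun i => i.elim0)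
    simp only [Finset.univ_eq_empty, Finset.prod_empty, mul_one] at h1
    have h2 := hasSum_unique c
    rw [taylorCoeff, h1.unique h2]
    exact congrArg c (Subsingleton.elim _ _)
  | succ n ih =>
    have hcons : ∀ (w : ℂ) (z : Fin n → ℂ), ‖w‖ < ρ → (∀ i, ‖z i‖ < ρ) →
        HasSum (fun x : (Fin n → ℕ) × ℕ => c (Fin.cons x.2 x.1) * w ^ x.2 * ∏ i, z i ^ x.1 i)
          (f (Fin.cons w z)) := by
      intro w z hw hz
      have h1 := h (Fin.cons w z) (fun i => by
        refine Fin.cases ?_ (fun j => ?_) i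
        · simpa using hw
        · simpa using hz j)
      rw [← (Fin.consEquiv fun _ => ℕ).hasSum_iff, ← (Equiv.prodComm _ _).hasSum_iff] at h1
      refine (congrArg (HasSum · _) (funext fun x => ?_)).mp h1
      have hx : (Fin.consEquiv fun _ => ℕ) (x.2, x.1) = Fin.cons x.2 x.1 := rfl
      simp only [Function.comp_apply, Equiv.prodComm_apply, Prod.swap, hx,
        Fin.prod_univ_succ, Fin.cons_zero, Fin.cons_succ]
      ring
    have hrow : ∀ (k : Fin n → ℕ) (w : ℂ), ‖w‖ < ρ →
        Summable fun j : ℕ => c (Fin.cons j k) * w ^ j := by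
      intro k w hw
      have hρ2 : ((ρ / 2 : ℝ) : ℂ) ≠ 0 := by
        exact_mod_cast (half_pos hρ).ne'
      have h1 := (hcons w (fun _ => ((ρ / 2 : ℝ) : ℂ)) hw (fun i => by
        rw [Complex.norm_real, Real.norm_of_nonneg (half_pos hρ).le]
        exact half_lt_self hρ)).summable.comp_injective (Prod.mk_right_injective k)
      refine (h1.mul_right (∏ i, ((ρ / 2 : ℝ) : ℂ) ^ k i)⁻¹).congr fun j => ?_
      exact mul_inv_cancel_right₀ (Finset.prod_ne_zero_iff.2 fun i _ => pow_ne_zero _ hρ2) _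
    set C : ℂ → (Fin n → ℕ) → ℂ := fun w k => ∑' j, c (Fin.cons j k) * w ^ j with hC
    have hfib : ∀ (w : ℂ) (z : Fin n → ℂ), ‖w‖ < ρ → (∀ i, ‖z i‖ < ρ) →
        HasSum (fun k => C w k * ∏ i, z i ^ k i) (f (Fin.cons w z)) := by
      intro w z hw hz
      have hrow' : ∀ k : Fin n → ℕ, HasSum (fun j : ℕ => c (Fin.cons j k) * w ^ j *
          ∏ i, z i ^ k i) (C w k * ∏ i, z i ^ k i) := fun k =>
        (hrow k w hw).hasSum.mul_right (∏ i, z i ^ k i)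
      exact HasSum.prod_fiberwise (hcons w z hw hz) hrow'
    have hin : ∀ w : ℂ, ‖w‖ < ρ →
        taylorCoeff n (fun z => f (Fin.cons w z)) (Fin.tail k) = C w (Fin.tail k) :=
      fun w hw => ih (c := C w) (fun z hz => hfib w z hw hz) (Fin.tail k)
    have hsum : ∀ w : ℂ, ‖w‖ < ρ → HasSum (fun j => c (Fin.cons j (Fin.tail k)) * w ^ j)
        (taylorCoeff n (fun z => f (Fin.cons w z)) (Fin.tail k)) := by
      intro w hw
      rw [hin w hw]
      exact (hrow _ w hw).hasSum
    have key := iteratedDeriv_div_factorial_of_hasSum hρ hsum (k 0)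
    rw [Fin.cons_self_tail] at key
    exact key

/-! ### The polynomials -/

/-- The exponent of the monomial `∏ k, Z_{2k} ^ μ k * ∏ i, B_i ^ d i`. -/
noncomputable def joinExponents {n : ℕ} (μ : ℕ+ →₀ ℕ) (d : Fin n → ℕ) : (ℕ+ ⊕ Fin n) →₀ ℕ :=
  μ.mapDomain Sum.inl + (Finsupp.equivFunOnFinite.symm d).mapDomain Sum.inr

theorem weight_joinExponents {n : ℕ} (μ : ℕ+ →₀ ℕ) (d : Fin n → ℕ) :
    Finsupp.weight (gradedDegree n) (joinExponents μ d) = zetaWeight μ + 2 * ∑ i, d i := by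
  rw [joinExponents, map_add, zetaWeight]
  congr 1
  · simp [Finsupp.weight_apply, Finsupp.sum_mapDomain_index, add_mul, gradedDegree]
  · rw [Finsupp.weight_apply, Finsupp.sum_mapDomain_index (by simp) (by simp [add_mul]),
      Finsupp.sum_fintype _ _ (by simp), Finset.mul_sum]
    refine Finset.sum_congr rfl fun i _ => ?_
    simp [gradedDegree, mul_comm]

theorem evalZeta_monomial_joinExponents {n : ℕ} (θ : CurveParam) (b : Fin n → ℕ+)
    (μ : ℕ+ →₀ ℕ) (d : Fin n → ℕ) (r : ℚ) :
    evalZeta θ.q θ.M b (MvPolynomial.monomial (joinExponents μ d) r) =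
      r * (zetaMonomial θ μ * ∏ i, (((b i : ℕ) : ℂ) ^ 2) ^ d i) := by
  rw [evalZeta, MvPolynomial.aeval_monomial, joinExponents,
    Finsupp.prod_add_index' (fun _ => pow_zero _) (fun _ _ _ => pow_add _ _ _),
    Finsupp.prod_mapDomain_index_inj Sum.inl_injective,
    Finsupp.prod_mapDomain_index_inj Sum.inr_injective, zetaMonomial]
  congr 2
  exact Finsupp.prod_fintype _ _ fun i => pow_zero _

/-- The value of `∏ i, β i ^ b i` for `b` in the parity class `ε`. -/
def paritySign {n : ℕ} (β : Fin n → ℤˣ) (ε : Fin n → ZMod 2) : ℚ :=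
  ∏ i, if ε i = 0 then 1 else ((β i : ℤ) : ℚ)

theorem paritySign_parityClass {n : ℕ} (β : Fin n → ℤˣ) (b : Fin n → ℕ+) :
    (paritySign β (parityClass b) : ℂ) = ∏ i, sgn (β i) ^ (b i : ℕ) := by
  rw [paritySign]
  push_cast
  refine Finset.prod_congr rfl fun i _ => ?_
  by_cases h : parityClass b i = 0
  · obtain ⟨j, hj⟩ := ((ZMod.natCast_eq_zero_iff_even).1 h)
    rw [if_pos h, hj, ← two_mul, pow_mul, sgn_sq, one_pow]
    simp
  · have h' : ¬ Even (b i : ℕ) := fun he => h (ZMod.natCast_eq_zero_iff_even.2 he)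
    obtain ⟨j, hj⟩ := Nat.not_even_iff_odd.1 h'
    rw [if_neg h, hj, pow_succ, pow_mul, sgn_sq, one_pow, one_mul]
    simp [sgn]

/-- The expansion at the origin of an admissible function: on each parity class the coefficients
are the values of a polynomial of bounded degree that does not depend on the curve. -/
theorem exists_polynomial_of_mem_adm {n : ℕ} {w : ℤ} {f : CurveParam → (Fin n → ℂ) → ℂ}
    (hf : f ∈ adm Finset.univ w) :
    ∃ P : (Fin n → ZMod 2) → MvPolynomial (ℕ+ ⊕ Fin n) ℚ,
      (∀ ε, ∀ s ∈ (P ε).support, (Finsupp.weight (gradedDegree n) s : ℤ) ≤ w) ∧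
      ∀ θ z, (∀ i, ‖z i‖ < Real.exp (-1)) →
        HasSum (fun b : Fin n → ℕ+ => evalZeta θ.q θ.M b (P (parityClass b)) *
          ∏ i, (((b i : ℕ) : ℂ) * z i ^ ((b i : ℕ) - 1))) (f θ z) := by
  obtain ⟨c, hc, hfc⟩ := hf
  suffices H : ∃ P : (Fin n → ZMod 2) → MvPolynomial (ℕ+ ⊕ Fin n) ℚ,
      (∀ ε, ∀ s ∈ (P ε).support, (Finsupp.weight (gradedDegree n) s : ℤ) ≤ w) ∧
      ∀ θ z, (∀ i, ‖z i‖ < Real.exp (-1)) →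
        HasSum (fun b : Fin n → ℕ+ => evalZeta θ.q θ.M b (P (parityClass b)) *
          ∏ i, (((b i : ℕ) : ℂ) * z i ^ ((b i : ℕ) - 1))) (c θ z) by
    obtain ⟨P, h1, h2⟩ := H
    refine ⟨P, h1, fun θ z hz => ?_⟩
    rw [hfc θ z fun i => ?_]
    · exact h2 θ z hz
    · have h3 : ‖z i‖ < 1 := (hz i).trans (Real.exp_lt_one_iff.2 (by norm_num))
      constructor <;> intro h <;> rw [h] at h3 <;> simp at h3
  clear hfc
  induction hc using Submodule.span_induction with
  | mem f hf =>
    obtain ⟨μ, β, d, hw, rfl⟩ := hf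
    refine ⟨fun ε => MvPolynomial.monomial (joinExponents μ d) (paritySign β ε),
      fun ε s hs => ?_, fun θ z hz => ?_⟩
    · have := MvPolynomial.support_monomial_subset hs
      rw [Finset.mem_singleton] at this
      rw [this, weight_joinExponents]
      exact_mod_cast hw
    · have h1 := (hasSum_prod_fin n fun i => hasSum_xi (β i) (d i) (hz i)).mul_left
        (zetaMonomial θ μ)
      refine (congrArg (HasSum · _) (funext fun b => ?_)).mp h1
      rw [evalZeta_monomial_joinExponents, paritySign_parityClass, mul_left_comm, mul_assoc,
        ← Finset.prod_mul_distrib, ← Finset.prod_mul_distrib]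
      congr 1
      refine Finset.prod_congr rfl fun i _ => ?_
      ring
  | zero =>
    refine ⟨fun _ => 0, by simp, fun θ z hz => ?_⟩
    simp [evalZeta]
  | add x y _ _ hx hy =>
    obtain ⟨P, h1, h2⟩ := hx
    obtain ⟨Q, h3, h4⟩ := hy
    classical
    refine ⟨fun ε => P ε + Q ε, fun ε s hs => ?_, fun θ z hz => ?_⟩
    · rcases Finset.mem_union.1 (MvPolynomial.support_add hs) with h | h
      · exact h1 ε s h
      · exact h3 ε s h
    · refine (congrArg (HasSum · _) (funext fun b => ?_)).mp ((h2 θ z hz).add (h4 θ z hz))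
      simp only [evalZeta, map_add]
      ring
  | smul r x _ hx =>
    obtain ⟨P, h1, h2⟩ := hx
    refine ⟨fun ε => r • P ε, fun ε s hs => h1 ε s (MvPolynomial.support_smul hs),
      fun θ z hz => ?_⟩
    have h3 := (h2 θ z hz).mul_left (r : ℂ)
    rw [Pi.smul_apply, Pi.smul_apply, Rat.smul_def]
    refine (congrArg (HasSum · _) (funext fun b => ?_)).mp h3
    simp only [evalZeta, map_smul, Rat.smul_def]
    ring

/-- For fixed `q` and `M`, a polynomial in the `q`-zeta values and the `b i ^ 2` is a polynomial in
the `b i ^ 2`. -/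
theorem evalZeta_eq_eval (q : ℂ) (M : ℕ) {n : ℕ} (b : Fin n → ℕ+)
    (P : MvPolynomial (ℕ+ ⊕ Fin n) ℚ) :
    evalZeta q M b P = MvPolynomial.eval (fun i => ((b i : ℕ) : ℂ) ^ 2)
      (MvPolynomial.aeval (Sum.elim (fun k : ℕ+ => MvPolynomial.C (truncatedQZeta q M k))
        MvPolynomial.X) P) := by
  rw [evalZeta]
  induction P using MvPolynomial.induction_on with
  | C r => simp
  | add p q hp hq => rw [map_add, map_add, map_add, hp, hq]
  | mul_X p i hp =>
    rw [map_mul, map_mul, map_mul, hp]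
    rcases i with k | i <;> simp

/-- The discrete volumes are the coefficients of the expansion of the correlation differentials. -/
theorem discreteVolume_eq_of_hasSum {n g : ℕ} (θ : CurveParam) {v : (Fin n → ℕ+) → ℂ} {ρ : ℝ}
    (hρ : 0 < ρ)
    (h : ∀ z : Fin n → ℂ, (∀ i, ‖z i‖ < ρ) → HasSum (fun b : Fin n → ℕ+ => v b *
      ∏ i, (((b i : ℕ) : ℂ) * z i ^ ((b i : ℕ) - 1))) (omegaFun g n θ z)) (b : Fin n → ℕ+) :
    discreteVolume θ.q θ.M g n b = v b := by
  have h1 := taylorCoeff_of_hasSum hρ n (f := omegaFun g n θ)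
    (c := fun k => v (fun i => (k i).succPNat) * ∏ i, ((k i : ℂ) + 1)) (fun z hz => by
      have h2 := h z hz
      rw [← (Equiv.piCongrRight fun _ : Fin n => Equiv.pnatEquivNat.symm).hasSum_iff] at h2
      refine (congrArg (HasSum · _) (funext fun k => ?_)).mp h2
      have hk : (Equiv.piCongrRight fun _ : Fin n => Equiv.pnatEquivNat.symm) k =
        fun i => (k i).succPNat := rfl
      rw [Function.comp_apply, hk, Finset.prod_mul_distrib, ← mul_assoc]
      simp) (fun i => (b i : ℕ) - 1)
  have hb : (fun i => ((b i : ℕ) - 1).succPNat) = b := by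
    funext i
    exact PNat.succPNat_natPred (b i)
  have hb' : ∏ i, ((((b i : ℕ) - 1 : ℕ) : ℂ) + 1) = ∏ i, ((b i : ℕ) : ℂ) := by
    refine Finset.prod_congr rfl fun i _ => ?_
    rw [← Nat.cast_add_one, Nat.sub_add_cancel (b i).pos]
  simp only [hb, hb'] at h1
  have hne : ∏ i, ((b i : ℕ) : ℂ) ≠ 0 :=
    Finset.prod_ne_zero_iff.2 fun i _ => Nat.cast_ne_zero.2 (b i).ne_zero
  rw [discreteVolume]
  exact (congrArg (· / _) h1).trans (mul_div_cancel_right₀ _ hne)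

end DiscreteVolume

open DiscreteVolume

/-- Here `q` is any complex number for which the curves are defined, in particular any
`0 < q < 1`. The first conjunct says that the discrete volumes are the coefficients of a convergent
expansion. In the third there is one rational polynomial for each parity class,
of bounded degree, that is chosen before `M` and `q`. -/
theorem theorem3p1 (g n : ℕ) (hn : 0 < n) (h01 : (g, n) ≠ (0, 1)) (h02 : (g, n) ≠ (0, 2)) :
    (∀ (M : ℕ) (q : ℂ), 0 < M → (∀ m ∈ Finset.Icc 1 M, q ^ m ≠ 1) →
      ∀ᶠ z in nhds (0 : Fin n → ℂ),
        HasSum (fun b : Fin n → ℕ+ =>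
            discreteVolume q M g n b * ∏ i, (((b i : ℕ) : ℂ) * z i ^ ((b i : ℕ) - 1)))
          ((truncatedCurve q M).omega g n z)) ∧
    (∀ (M : ℕ) (q : ℂ), 0 < M → (∀ m ∈ Finset.Icc 1 M, q ^ m ≠ 1) →
      IsQuasiPolynomialInSquares (discreteVolume q M g n)) ∧
    (∃ P : (Fin n → ZMod 2) → MvPolynomial (ℕ+ ⊕ Fin n) ℚ,
      (∀ ε, (((P ε).weightedTotalDegree (gradedDegree n) : ℕ) : ℤ) ≤ 6 * g - 6 + 2 * n) ∧
      ∀ (M : ℕ) (q : ℂ), 0 < M → (∀ m ∈ Finset.Icc 1 M, q ^ m ≠ 1) →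
        ∀ b : Fin n → ℕ+, discreteVolume q M g n b = evalZeta q M b (P (parityClass b))) := by
  rw [Ne, Prod.mk.injEq] at h01 h02
  obtain ⟨P, hdeg, hsum⟩ := exists_polynomial_of_mem_adm (omegaFun_mem_adm g n hn h01 h02)
  have hvol : ∀ (M : ℕ) (q : ℂ), (∀ m ∈ Finset.Icc 1 M, q ^ m ≠ 1) → ∀ b : Fin n → ℕ+,
      discreteVolume q M g n b = evalZeta q M b (P (parityClass b)) := fun M q hq =>
    discreteVolume_eq_of_hasSum ⟨M, q, hq⟩ (Real.exp_pos (-1)) (hsum ⟨M, q, hq⟩)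
  refine ⟨fun M q _ hq => ?_, fun M q _ hq ε => ?_, P, fun ε => ?_, fun M q _ hq => hvol M q hq⟩
  · filter_upwards [Metric.ball_mem_nhds (0 : Fin n → ℂ) (Real.exp_pos (-1))] with z hz
    rw [mem_ball_zero_iff, pi_norm_lt_iff (Real.exp_pos _)] at hz
    simp only [hvol M q hq]
    exact hsum ⟨M, q, hq⟩ z hz
  · refine ⟨MvPolynomial.aeval (Sum.elim (fun k : ℕ+ => MvPolynomial.C (truncatedQZeta q M k))
      MvPolynomial.X) (P ε), fun b hb => ?_⟩
    rw [hvol M q hq, hb, evalZeta_eq_eval]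
  -- The bound is nonnegative because `(g, n)` is stable.
  · obtain ⟨D, hD⟩ : ∃ D : ℕ, (6 * g - 6 + 2 * n : ℤ) = D := Int.eq_ofNat_of_zero_le (by omega)
    rw [hD] at hdeg ⊢
    exact_mod_cast Finset.sup_le fun s hs => by exact_mod_cast hdeg ε s hs
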